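/- Let $\mathcal X,\mathcal Y$ (inputs, non-empty) and $\mathcal A,\mathcal B$ (outcomes) be finite sets. A conditional distribution $p(a,b|x,y)$ is *non-signaling* if $\sum_b p(a,b|x,y)$ does not depend on $y$ and $\sum_a p(a,b|x,y)$ does not depend on $x$. It is *local* if it is a convex combination of distributions $\delta_{a=\lambda_A(x)}\delta_{b=\lambda_B(y)}$ with $\lambda_A:\mathcal X\to\mathcal A$, $\lambda_B:\mathcal Y\to\mathcal B$. It is *quantum* if $p(a,b|x,y)=\langle\psi|E_a(x)F_b(y)|\psi\rangle$ for a unit vector $\psi$ of a complex Hilbert space and projective measurements $\{E_a(x)\}_a$, $\{F_b(y)\}_b$ with $E_a(x)F_b(y)=F_b(y)E_a(x)$. Let $\mathcal L$ and $\mathcal Q$ be the sets of local and of quantum distributions, and let $\delta(\mathbf p,\mathbf p')=\max_{x,y,\mathcal E\subseteq\mathcal A\times\mathcal B}|p(\mathcal E|x,y)-p'(\mathcal E|x,y)|$. For a non-signaling $\mathbf p$ and $\epsilon\ge 0$ put $$\tilde\nu(\mathbf p)=\inf\Big\{\sum_i|q_i| : \mathbf p=\sum_i q_i\mathbf p_i,\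 q_i\in\mathbb R,\ \mathbf p_i\in\mathcal L\Big\},\qquad \tilde\gamma_2(\mathbf p)=\inf\Big\{\sum_i|q_i| : \mathbf p=\sum_i q_i\mathbf p_i,\ q_i\in\mathbb R,\ \mathbf p_i\in\mathcal Q\Big\}$$ (finite sums), and let $\tilde\nu^\epsilon(\mathbf p)$, $\tilde\gamma_2^\epsilon(\mathbf p)$ be the infima of $\tilde\nu(\mathbf p')$, $\tilde\gamma_2(\mathbf p')$ over the non-signaling $\mathbf p'$ with $\delta(\mathbf p,\mathbf p')\le\epsilon$. Let $R_0^{\mathrm{pub}}(\mathbf p)$ be the least number $t$ such that some classical two-party protocol with shared randomness and at most $t$ bits of communication, in which on inputs $x,y$ Alice outputs $a$ and Bob outputs $b$, has output distribution exactly $p(a,b|x,y)$. Let $Q_0^{\mathrm{ent}}(\mathbf p)$ be the least number $q$ of qubits of communication with which $\mathbf p$ can be simulated exactly by a quantum protocol with shared entanglement: the players share a state of a Hilbert space on which the operators of Alice commute with those of Bob (for example a tensor product of two registers, of any dimension), in every round a prescribed player applies a unitary to his own part and sends one qubit to the other player, and in the end each player measures his own part. Let $R_\epsilon^{\mathrm{pub}}(\mathbf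 p)$, $Q_\epsilon^{\mathrm{ent}}(\mathbf p)$ be the minima of $R_0^{\mathrm{pub}}(\mathbf p')$, $Q_0^{\mathrm{ent}}(\mathbf p')$ over the non-signaling $\mathbf p'$ with $\delta(\mathbf p,\mathbf p')\le\epsilon$. For $C:\mathcal X\times\mathcal Y\to[-1,1]$ identify $C$ with the distribution with outcomes $a,b\in\{\pm1\}$, uniform marginals and correlations $C$, that is, $p(a,b|x,y)=\frac14(1+ab\,C(x,y))$. Then, for every non-signaling $\mathbf p$, every $C:\mathcal X\times\mathcal Y\to[-1,1]$ and every $\epsilon\ge0$, with logarithms to base $2$: 1. $R_0^{\mathrm{pub}}(\mathbf p)\ge\log\tilde\nu(\mathbf p)-1$ and $R_\epsilon^{\mathrm{pub}}(\mathbf p)\ge\log\tilde\nu^\epsilon(\mathbf p)-1$; 2. $Q_0^{\mathrm{ent}}(\mathbf p)\ge\frac12\log\tilde\gamma_2(\mathbf p)-1$ and $Q_\epsilon^{\mathrm{ent}}(\mathbf p)\ge\frac12\log\tilde\gamma_2^\epsilon(\mathbf p)-1$; 3. $Q_0^{\mathrm{ent}}(C)\ge\log\tilde\gamma_2(C)$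 and $Q_\epsilon^{\mathrm{ent}}(C)\ge\log\tilde\gamma_2^\epsilon(C)$. -/

import Mathlib

open scoped BigOperators

noncomputable section

/-! ### Bipartite conditional distributions

`p x y a b` is the probability `p(a,b|x,y)` of outcomes `a, b` on inputs `x, y`. -/

/-- Real tables indexed by inputs and outcomes, as a real vector space. -/
abbrev Table (X Y A B : Type*) : Type _ := X → Y → A → B → ℝ

/-- `p` is a non-signaling conditional distribution. -/
structure NonSignaling {X Y A B : Type*} [Fintype A] [Fintype B] (p : Table X Y A B) : Prop where
  nonneg : ∀ x y a b, 0 ≤ p x y a b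
  sum_eq_one : ∀ x y, ∑ a, ∑ b, p x y a b = 1
  alice : ∀ a x y y', ∑ b, p x y a b = ∑ b, p x y' a b
  bob : ∀ b x x' y, ∑ a, p x y a b = ∑ a, p x' y a b

/-- The statistical distance: the largest difference of the probabilities of an event, over all
inputs and all events. -/
def tvDist {X Y A B : Type*} (p p' : Table X Y A B) : ℝ :=
  ⨆ z : X × Y × Finset (A × B),
    |∑ e ∈ z.2.2, p z.1 z.2.1 e.1 e.2 - ∑ e ∈ z.2.2, p' z.1 z.2.1 e.1 e.2|

/-- The binary distribution `(C, 0, 0)` with correlations `C` and uniform marginals; the outcomes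
are `±1`, that is, the elements of `ℤˣ`. -/
def uniformMarginals {X Y : Type*} (C : X → Y → ℝ) : Table X Y ℤˣ ℤˣ :=
  fun x y a b => (1 + ((a : ℤ) : ℝ) * ((b : ℤ) : ℝ) * C x y) / 4

/-! ### Local and quantum distributions -/

open Classical in
/-- The local deterministic distribution given by the two output functions. -/
def localDet {X Y A B : Type*} (l : (X → A) × (Y → B)) : Table X Y A B :=
  fun x y a b => (if a = l.1 x then 1 else 0) * (if b = l.2 y then 1 else 0)

/-- Local distributions: convex combinations of local deterministic ones. -/
def localSet (X Y A B : Type*) : Set (Table X Y A B) :=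
  convexHull ℝ (Set.range localDet)

open Classical in
/-- A complete family of mutually orthogonal self-adjoint projections, indexed by outcomes. -/
structure IsProjMeas {A R : Type*} [Fintype A] [Ring R] [StarRing R] (E : A → R) : Prop where
  selfAdjoint : ∀ a, star (E a) = E a
  mul_eq : ∀ a a', E a * E a' = if a = a' then E a else 0
  sum_eq_one : ∑ a, E a = 1

/-- Quantum distributions: those obtained by commuting projective measurements of a pure state in
a complex Hilbert space (of arbitrary dimension). -/
def quantumSet (X Y A B : Type*) [Fintype A] [Fintype B] : Set (Table X Y A B) :=
  {p | ∃ (H : Type) (_ : NormedAddCommGroup H) (_ : InnerProductSpace ℂ H) (_ : CompleteSpace H)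
      (ψ : H) (E : X → A → H →L[ℂ] H) (F : Y → B → H →L[ℂ] H),
      ‖ψ‖ = 1 ∧ (∀ x, IsProjMeas (E x)) ∧ (∀ y, IsProjMeas (F y)) ∧
      (∀ x y a b, E x a * F y b = F y b * E x a) ∧
      ∀ x y a b, (p x y a b : ℂ) = inner ℂ ψ ((E x a * F y b) ψ)}

/-! ### Affine models -/

/-- The least `∑ |qᵢ|` over the finite representations `p = ∑ qᵢ pᵢ` with real `qᵢ` and
`pᵢ ∈ S`. -/
def affineCost {X Y A B : Type*} (S : Set (Table X Y A B)) (p : Table X Y A B) : ℝ :=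
  sInf {s | ∃ (n : ℕ) (q : Fin n → ℝ) (P : Fin n → Table X Y A B),
    (∀ i, P i ∈ S) ∧ p = ∑ i, q i • P i ∧ s = ∑ i, |q i|}

/-- The least value of `affineCost S` on the non-signaling distributions at statistical distance
at most `ε` from `p`. -/
def affineCostApprox {X Y A B : Type*} [Fintype A] [Fintype B] (S : Set (Table X Y A B))
    (ε : ℝ) (p : Table X Y A B) : ℝ :=
  sInf {s | ∃ p' : Table X Y A B, NonSignaling p' ∧ tvDist p p' ≤ ε ∧ s = affineCost S p'}

/-- `ν̃(p)` -/
def nuTilde {X Y A B : Type*} (p : Table X Y A B) : ℝ :=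
  affineCost (localSet X Y A B) p

/-- `ν̃^ε(p)` -/
def nuTildeApprox {X Y A B : Type*} [Fintype A] [Fintype B] (ε : ℝ) (p : Table X Y A B) : ℝ :=
  affineCostApprox (localSet X Y A B) ε p

/-- `γ̃₂(p)` -/
def gammaTilde {X Y A B : Type*} [Fintype A] [Fintype B] (p : Table X Y A B) : ℝ :=
  affineCost (quantumSet X Y A B) p

/-- `γ̃₂^ε(p)` -/
def gammaTildeApprox {X Y A B : Type*} [Fintype A] [Fintype B] (ε : ℝ) (p : Table X Y A B) : ℝ :=
  affineCostApprox (quantumSet X Y A B) ε p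

/-! ### Classical protocols with public randomness -/

/-- Deterministic two-party protocols, as trees: at an inner node one player sends a bit that
depends on his own input (and, through the node, on the transcript); at a leaf each player
produces an outcome that depends on his own input (and on the transcript). -/
inductive CProtocol (X Y A B : Type*)
  | output (outA : X → A) (outB : Y → B) : CProtocol X Y A B
  | aliceSends (bit : X → Bool) (next : Bool → CProtocol X Y A B) : CProtocol X Y A B
  | bobSends (bit : Y → Bool) (next : Bool → CProtocol X Y A B) : CProtocol X Y A B

/-- The number of bits exchanged in the worst case. -/
def CProtocol.cost {X Y A B : Type*} : CProtocol X Y A B → ℕ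
  | .output _ _ => 0
  | .aliceSends _ next => 1 + max (next false).cost (next true).cost
  | .bobSends _ next => 1 + max (next false).cost (next true).cost

/-- The pair of outcomes on given inputs. -/
def CProtocol.run {X Y A B : Type*} : CProtocol X Y A B → X → Y → A × B
  | .output outA outB, x, y => (outA x, outB y)
  | .aliceSends bit next, x, y => (next (bit x)).run x y
  | .bobSends bit next, x, y => (next (bit y)).run x y

/-- `p` is the output distribution of a public-coin protocol, that is, of a probability
distribution `μ` on deterministic protocols, with at most `t` bits of communication. Private
coins are covered, as parts of the public one. -/
def ClassicalSim {X Y A B : Type*} (t : ℕ) (p : Table X Y A B) : Prop :=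
  ∃ μ : PMF (CProtocol X Y A B), (∀ P ∈ μ.support, P.cost ≤ t) ∧
    ∀ x y a b, p x y a b = ((μ.map fun P => P.run x y) (a, b)).toReal

/-! ### Quantum protocols with shared entanglement -/

/-- The two players. -/
inductive Party
  | alice
  | bob

/-- Operators on `H ⊗ (ℂ²)^{⊗ q}`, written as matrices of operators on `H` in the computational
basis `{0,1}^q` of the `q` qubits. -/
abbrev QOp (q : ℕ) (H : Type*) [NormedAddCommGroup H] [InnerProductSpace ℂ H] : Type _ :=
  Matrix (Fin q → Bool) (Fin q → Bool) (H →L[ℂ] H)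

/-- `M` belongs to `𝒜 ⊗ B((ℂ²)^{⊗ S}) ⊗ 1`: it acts on `H` through the algebra `𝒜`, acts on the
qubits of `S`, and is the identity on all other qubits. -/
structure ActsOn {q : ℕ} {H : Type*} [NormedAddCommGroup H] [InnerProductSpace ℂ H]
    [CompleteSpace H] (𝒜 : StarSubalgebra ℂ (H →L[ℂ] H)) (S : Set (Fin q)) (M : QOp q H) :
    Prop where
  mem : ∀ s t, M s t ∈ 𝒜
  eq_zero : ∀ s t, (∃ i, i ∉ S ∧ s i ≠ t i) → M s t = 0
  eq_of_agree : ∀ s t s' t', (∀ i ∈ S, s i = s' i ∧ t i = t' i) →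
    (∀ i, i ∉ S → s i = t i ∧ s' i = t' i) → M s t = M s' t'

/-- Quantum protocols with shared entanglement and `q` qubits of communication. The players share
a pure state `ψ` of a Hilbert space `H`. Alice and Bob can act on `H` through the commuting
algebras `algA` and `algB` (in the tensor product setting `H = H_A ⊗ H_B` these are
`B(H_A) ⊗ 1` and `1 ⊗ B(H_B)`). The `i`-th communicated qubit starts in the state `|0⟩` in the
hands of `sender i`. In round `i` this player applies a unitary, depending on his input, to his
part of `H`, to the qubits that he received in earlier rounds and to qubit `i`, which is then
handed to the other player. In the end each player measures his part of `H` together with all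
the qubits that he has received. -/
structure QProtocol (X Y A B : Type*) [Fintype A] [Fintype B] (q : ℕ) (H : Type*)
    [NormedAddCommGroup H] [InnerProductSpace ℂ H] [CompleteSpace H] where
  ψ : H
  norm_ψ : ‖ψ‖ = 1
  algA : StarSubalgebra ℂ (H →L[ℂ] H)
  algB : StarSubalgebra ℂ (H →L[ℂ] H)
  commute : ∀ S ∈ algA, ∀ T ∈ algB, S * T = T * S
  sender : Fin q → Party
  opA : X → Fin q → QOp q H
  opB : Y → Fin q → QOp q H
  opA_unitary : ∀ x i, sender i = .alice → opA x i ∈ unitary (QOp q H)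
  opB_unitary : ∀ y i, sender i = .bob → opB y i ∈ unitary (QOp q H)
  opA_acts : ∀ x i, sender i = .alice →
    ActsOn algA ({j | j < i ∧ sender j = .bob} ∪ {i}) (opA x i)
  opB_acts : ∀ y i, sender i = .bob →
    ActsOn algB ({j | j < i ∧ sender j = .alice} ∪ {i}) (opB y i)
  measA : X → A → QOp q H
  measB : Y → B → QOp q H
  measA_proj : ∀ x, IsProjMeas (measA x)
  measB_proj : ∀ y, IsProjMeas (measB y)
  measA_acts : ∀ x a, ActsOn algA {j | sender j = .bob} (measA x a)
  measB_acts : ∀ y b, ActsOn algB {j | sender j = .alice} (measB y b)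

namespace QProtocol

variable {X Y A B : Type*} [Fintype A] [Fintype B] {q : ℕ} {H : Type*}
  [NormedAddCommGroup H] [InnerProductSpace ℂ H] [CompleteSpace H]

/-- The unitary applied in round `i`. -/
def roundOp (π : QProtocol X Y A B q H) (x : X) (y : Y) (i : Fin q) : QOp q H :=
  match π.sender i with
  | .alice => π.opA x i
  | .bob => π.opB y i

/-- The product of all rounds, the first one acting first. -/
def totalOp (π : QProtocol X Y A B q H) (x : X) (y : Y) : QOp q H :=
  (List.ofFn fun i => π.roundOp x y i).reverse.prod

/-- The probability of the outcomes `a, b`: the expectation of the product of the two projections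
in the final state `W (ψ ⊗ |0…0⟩)`. -/
def prob (π : QProtocol X Y A B q H) (x : X) (y : Y) (a : A) (b : B) : ℂ :=
  inner ℂ π.ψ
    ((star (π.totalOp x y) * (π.measA x a * π.measB y b) * π.totalOp x y)
      (fun _ => false) (fun _ => false) π.ψ)

end QProtocol

/-- `p` is the output distribution of an entanglement-assisted quantum protocol with `q` qubits of
communication. -/
def QuantumSim {X Y A B : Type*} [Fintype A] [Fintype B] (q : ℕ) (p : Table X Y A B) : Prop :=
  ∃ (H : Type) (_ : NormedAddCommGroup H) (_ : InnerProductSpace ℂ H) (_ : CompleteSpace H)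
    (π : QProtocol X Y A B q H), ∀ x y a b, (p x y a b : ℂ) = π.prob x y a b

/-! ### Communication complexity -/

/-- The least amount of communication for which `p` can be simulated (`⊤` if there is none). -/
def exactComplexity {X Y A B : Type*} (Sim : ℕ → Table X Y A B → Prop) (p : Table X Y A B) : ℕ∞ :=
  ⨅ (t : ℕ) (_ : Sim t p), (t : ℕ∞)

/-- The least amount of communication for which some non-signaling distribution at statistical
distance at most `ε` from `p` can be simulated. -/
def approxComplexity {X Y A B : Type*} [Fintype A] [Fintype B]
    (Sim : ℕ → Table X Y A B → Prop) (ε : ℝ) (p : Table X Y A B) : ℕ∞ :=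
  ⨅ (p' : Table X Y A B) (_ : NonSignaling p') (_ : tvDist p p' ≤ ε), exactComplexity Sim p'

/-- `R₀^pub(p)` -/
def R0pub {X Y A B : Type*} (p : Table X Y A B) : ℕ∞ :=
  exactComplexity ClassicalSim p

/-- `R_ε^pub(p)` -/
def Rpub {X Y A B : Type*} [Fintype A] [Fintype B] (ε : ℝ) (p : Table X Y A B) : ℕ∞ :=
  approxComplexity ClassicalSim ε p

/-- `Q₀^ent(p)` -/
def Q0ent {X Y A B : Type*} [Fintype A] [Fintype B] (p : Table X Y A B) : ℕ∞ :=
  exactComplexity QuantumSim p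

/-- `Q_ε^ent(p)` -/
def Qent {X Y A B : Type*} [Fintype A] [Fintype B] (ε : ℝ) (p : Table X Y A B) : ℕ∞ :=
  approxComplexity QuantumSim ε p

end

/-!
A protocol in which the players share randomness or entanglement but do not communicate can still
reproduce a communication protocol by post-selection. In the classical case the players read a guess
of the transcript off the shared randomness, and a player whose own bits contradict the guess
aborts; `t` bits are guessed with probability `2 ^ (-t)`. In the quantum case every transmitted
qubit is teleported, and a player aborts unless no correction is required; `q` qubits get through
with probability `4 ^ (-q)`. Thus `p / N`, with `N = 2 ^ t` or `N = 4 ^ q`, is the restriction of a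
local or quantum distribution `R` to the runs without abort. Since `p` and `R` are non-signaling,
letting a player who aborts output a sample of his marginal of `p` yields a distribution `P` for
which `N P - p` is a sum of two product distributions of total weight `N - 1`. Hence the cost of `p`
is at most `2 N - 1`.

For correlations the loss is only `2 ^ q`. If Alice sends `m` and Bob sends `n` of the `q` qubits,
then each of Alice's outcomes other than abort is assigned a component of the shared state; the
components are orthogonal, and their sum `u x`, with signs `±1`, has norm exactly `2 ^ (-m)`.
Likewise Bob's vector `v y` has norm `2 ^ (-n)`, so the correlations `4 ^ q ⟨u x, v y⟩` are `2 ^ q`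
times inner products of unit vectors, which are quantum correlations by Tsirelson's theorem.
-/

noncomputable section

section AffineCost

variable {X Y A B : Type*} {S : Set (Table X Y A B)} {p : Table X Y A B}

theorem affineCost_nonneg (S : Set (Table X Y A B)) (p : Table X Y A B) : 0 ≤ affineCost S p := by
  refine Real.sInf_nonneg ?_
  rintro s ⟨n, q, P, -, -, rfl⟩
  positivity

theorem affineCost_le {n : ℕ} (q : Fin n → ℝ) (P : Fin n → Table X Y A B) (hP : ∀ i, P i ∈ S)
    (hp : p = ∑ i, q i • P i) : affineCost S p ≤ ∑ i, |q i| := by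
  refine csInf_le ⟨0, ?_⟩ ⟨n, q, P, hP, hp, rfl⟩
  rintro s ⟨n, q, P, -, -, rfl⟩
  positivity

theorem affineCostApprox_nonneg [Fintype A] [Fintype B] (S : Set (Table X Y A B)) (ε : ℝ)
    (p : Table X Y A B) : 0 ≤ affineCostApprox S ε p := by
  refine Real.sInf_nonneg ?_
  rintro s ⟨p', -, -, rfl⟩
  exact affineCost_nonneg S p'

theorem affineCostApprox_le [Fintype A] [Fintype B] {ε : ℝ} {p' : Table X Y A B}
    (hp' : NonSignaling p') (hε : tvDist p p' ≤ ε) :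
    affineCostApprox S ε p ≤ affineCost S p' := by
  refine csInf_le ⟨0, ?_⟩ ⟨p', hp', hε, rfl⟩
  rintro s ⟨p', -, -, rfl⟩
  exact affineCost_nonneg S p'

end AffineCost

/-! ### Local post-processing -/

section Postprocess

variable {X Y A B A' B' : Type*}

/-- The distribution of independent outcomes, with Alice's distributed according to `s` and Bob's
according to `t`. -/
def prodTable (s : X → A → ℝ) (t : Y → B → ℝ) : Table X Y A B := fun x y a b => s x a * t y b

/-- The effect on a distribution `R` of resampling the outcomes: on input `x`, Alice replaces her
outcome `a` by one distributed according to `κ x a`, and Bob does the same with `η`. -/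
def postprocess [Fintype A] [Fintype B] (κ : X → A → A' → ℝ) (η : Y → B → B' → ℝ) :
    Table X Y A B →ₗ[ℝ] Table X Y A' B' where
  toFun R x y a' b' := ∑ a, ∑ b, κ x a a' * η y b b' * R x y a b
  map_add' R R' := by
    ext x y a' b'
    simp only [Pi.add_apply, mul_add, Finset.sum_add_distrib]
  map_smul' c R := by
    ext x y a' b'
    simp only [Pi.smul_apply, smul_eq_mul, Finset.mul_sum, RingHom.id_apply, mul_left_comm c]

theorem postprocess_apply [Fintype A] [Fintype B] (κ : X → A → A' → ℝ) (η : Y → B → B' → ℝ)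
    (R : Table X Y A B) (x : X) (y : Y) (a' : A') (b' : B') :
    postprocess κ η R x y a' b' = ∑ a, ∑ b, κ x a a' * η y b b' * R x y a b := rfl

theorem postprocess_const [Fintype A] [Fintype B] {R : Table X Y A B}
    (hR : ∀ x y, ∑ a, ∑ b, R x y a b = 1) (s : X → A' → ℝ) (t : Y → B' → ℝ) :
    postprocess (fun x _ => s x) (fun y _ => t y) R = prodTable s t := by
  ext x y a' b'
  simp only [postprocess_apply, prodTable, ← Finset.mul_sum, hR, mul_one]

theorem localDet_eq_prodTable [DecidableEq A] [DecidableEq B] (l : (X → A) × (Y → B)) :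
    localDet l = prodTable (fun x => Pi.single (l.1 x) 1) (fun y => Pi.single (l.2 y) 1) := by
  ext x y a b
  simp only [localDet, prodTable, Pi.single_apply]
  congr

theorem postprocess_localDet [Fintype A] [Fintype B] (κ : X → A → A' → ℝ) (η : Y → B → B' → ℝ)
    (l : (X → A) × (Y → B)) :
    postprocess κ η (localDet l) = prodTable (fun x => κ x (l.1 x)) (fun y => η y (l.2 y)) := by
  classical
  ext x y a' b'
  simp [postprocess_apply, prodTable, localDet]

end Postprocess

section LocalSet

variable {X Y A B A' B' : Type*}

theorem mem_convexHull_range_single [Finite X] [Fintype A] [DecidableEq A] {s : X → A → ℝ}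
    (hs : ∀ x, s x ∈ stdSimplex ℝ A) :
    s ∈ convexHull ℝ (Set.range fun (l : X → A) (x : X) => (Pi.single (l x) 1 : A → ℝ)) := by
  have hpi : s ∈ convexHull ℝ
      (Set.univ.pi fun _ : X => Set.range fun a : A => Pi.single a (1 : ℝ)) :=
    mem_convexHull_pi fun x _ => (convexHull_rangle_single_eq_stdSimplex ℝ A).symm ▸ hs x
  refine convexHull_mono (fun r hr => ?_) hpi
  choose l hl using fun x => hr x trivial
  exact ⟨l, funext hl⟩

theorem prodTable_mem_localSet [Finite X] [Finite Y] [Fintype A] [Fintype B] {s : X → A → ℝ}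
    {t : Y → B → ℝ} (hs : ∀ x, s x ∈ stdSimplex ℝ A) (ht : ∀ y, t y ∈ stdSimplex ℝ B) :
    prodTable s t ∈ localSet X Y A B := by
  classical
  let f : (X → A → ℝ) →ₗ[ℝ] (Y → B → ℝ) →ₗ[ℝ] Table X Y A B :=
    LinearMap.mk₂ ℝ prodTable (fun _ _ _ => by ext; simp [prodTable, add_mul])
      (fun _ _ _ => by ext; simp [prodTable, mul_assoc])
      (fun _ _ _ => by ext; simp [prodTable, mul_add])
      (fun _ _ _ => by ext; simp [prodTable, mul_left_comm])
  have hconv : Convex ℝ (localSet X Y A B) := convex_convexHull ℝ _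
  refine convexHull_min ?_ (hconv.linear_preimage (f.flip t)) (mem_convexHull_range_single hs)
  rintro _ ⟨l, rfl⟩
  refine convexHull_min ?_ (hconv.linear_preimage (f _)) (mem_convexHull_range_single ht)
  rintro _ ⟨m, rfl⟩
  exact subset_convexHull ℝ _ ⟨(l, m), localDet_eq_prodTable (l, m)⟩

theorem postprocess_mem_localSet [Finite X] [Finite Y] [Fintype A] [Fintype B] [Fintype A']
    [Fintype B'] {κ : X → A → A' → ℝ} {η : Y → B → B' → ℝ}
    (hκ : ∀ x a, κ x a ∈ stdSimplex ℝ A') (hη : ∀ y b, η y b ∈ stdSimplex ℝ B')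
    {R : Table X Y A B} (hR : R ∈ localSet X Y A B) :
    postprocess κ η R ∈ localSet X Y A' B' := by
  refine convexHull_min ?_ ((convex_convexHull ℝ _).linear_preimage (postprocess κ η)) hR
  rintro _ ⟨l, rfl⟩
  rw [Set.mem_preimage, postprocess_localDet]
  exact prodTable_mem_localSet (fun x => hκ x _) fun y => hη y _

theorem nonSignaling_prodTable [Fintype A] [Fintype B] {s : X → A → ℝ} {t : Y → B → ℝ}
    (hs : ∀ x, s x ∈ stdSimplex ℝ A) (ht : ∀ y, t y ∈ stdSimplex ℝ B) :
    NonSignaling (prodTable s t) where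
  nonneg x y a b := mul_nonneg ((hs x).1 a) ((ht y).1 b)
  sum_eq_one x y := by simp only [prodTable, ← Finset.mul_sum, (ht y).2, (hs x).2, mul_one]
  alice a x y y' := by simp only [prodTable, ← Finset.mul_sum, (ht _).2]
  bob b x x' y := by simp only [prodTable, ← Finset.sum_mul, (hs _).2]

theorem convex_setOf_nonSignaling [Fintype A] [Fintype B] :
    Convex ℝ {p : Table X Y A B | NonSignaling p} := by
  intro p hp p' hp' s t hs ht hst
  refine ⟨fun x y a b => ?_, fun x y => ?_, fun a x y y' => ?_, fun b x x' y => ?_⟩ <;>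
    simp only [Pi.add_apply, Pi.smul_apply, smul_eq_mul, Finset.sum_add_distrib, ← Finset.mul_sum]
  · exact add_nonneg (mul_nonneg hs (hp.nonneg ..)) (mul_nonneg ht (hp'.nonneg ..))
  · rw [hp.sum_eq_one, hp'.sum_eq_one, mul_one, mul_one, hst]
  · rw [hp.alice a x y y', hp'.alice a x y y']
  · rw [hp.bob b x x' y, hp'.bob b x x' y]

theorem nonSignaling_of_mem_localSet [Fintype A] [Fintype B] {p : Table X Y A B}
    (hp : p ∈ localSet X Y A B) : NonSignaling p := by
  classical
  refine convexHull_min ?_ convex_setOf_nonSignaling hp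
  rintro _ ⟨l, rfl⟩
  rw [localDet_eq_prodTable]
  exact nonSignaling_prodTable (fun x => single_mem_stdSimplex ℝ _)
    fun y => single_mem_stdSimplex ℝ _

end LocalSet

/-! ### Affine models from post-selection -/

section Postselection

variable {X Y A B : Type*}

open Classical in
/-- The kernel that keeps an outcome `some a` and resamples the outcome `none` according to `s`. -/
def fillKernel (s : X → A → ℝ) (x : X) (o : Option A) : A → ℝ :=
  o.elim (s x) fun a => Pi.single a 1

theorem fillKernel_mem_stdSimplex [Fintype A] {s : X → A → ℝ} (hs : ∀ x, s x ∈ stdSimplex ℝ A)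
    (x : X) (o : Option A) : fillKernel s x o ∈ stdSimplex ℝ A := by
  classical
  cases o with
  | none => exact hs x
  | some a => convert! single_mem_stdSimplex ℝ a

theorem postprocess_fillKernel_apply [Fintype A] [Fintype B] (s : X → A → ℝ) (t : Y → B → ℝ)
    (R : Table X Y (Option A) (Option B)) (x : X) (y : Y) (a : A) (b : B) :
    postprocess (fillKernel s) (fillKernel t) R x y a b =
      R x y (some a) (some b) + t y b * R x y (some a) none + s x a * R x y none (some b) +
        s x a * t y b * R x y none none := by
  classical
  simp only [postprocess_apply, fillKernel, Fintype.sum_option, Option.elim, Pi.single_apply,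
    ite_mul, mul_ite, one_mul, zero_mul, mul_one, mul_zero, Finset.sum_add_distrib,
    Finset.sum_ite_eq, Finset.mem_univ, if_true]
  ring

namespace NonSignaling

theorem exists_alice_marginal [Nonempty Y] [Fintype A] [Fintype B] {p : Table X Y A B}
    (hp : NonSignaling p) :
    ∃ u : X → A → ℝ, (∀ x, u x ∈ stdSimplex ℝ A) ∧ ∀ x y a, ∑ b, p x y a b = u x a := by
  obtain ⟨y₀⟩ := ‹Nonempty Y›
  exact ⟨fun x a => ∑ b, p x y₀ a b, fun x => ⟨fun a => Finset.sum_nonneg fun b _ => hp.nonneg ..,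
    hp.sum_eq_one x y₀⟩, fun x y a => hp.alice a x y y₀⟩

theorem exists_bob_marginal [Nonempty X] [Fintype A] [Fintype B] {p : Table X Y A B}
    (hp : NonSignaling p) :
    ∃ v : Y → B → ℝ, (∀ y, v y ∈ stdSimplex ℝ B) ∧ ∀ x y b, ∑ a, p x y a b = v y b := by
  obtain ⟨x₀⟩ := ‹Nonempty X›
  exact ⟨fun y b => ∑ a, p x₀ y a b, fun y => ⟨fun b => Finset.sum_nonneg fun a _ => hp.nonneg ..,
    Finset.sum_comm.trans (hp.sum_eq_one x₀ y)⟩, fun x y b => hp.bob b x x₀ y⟩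

end NonSignaling

theorem exists_add_eq_of_forall_add_le [Finite X] [Nonempty X] {F : X → ℝ} {G : Y → ℝ} {M : ℝ}
    (h : ∀ x y, F x + G y ≤ M) : ∃ c d, c + d = M ∧ (∀ x, F x ≤ c) ∧ ∀ y, G y ≤ d := by
  obtain ⟨x₀, hx₀⟩ := Finite.exists_max F
  exact ⟨F x₀, M - F x₀, by ring, hx₀, fun y => by linarith [h x₀ y]⟩

theorem exists_mem_stdSimplex_smul_eq [Fintype A] {u f : A → ℝ} {c : ℝ} (hu : u ∈ stdSimplex ℝ A)
    (hf : 0 ≤ f) (hc : ∑ a, f a ≤ c) :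
    ∃ s ∈ stdSimplex ℝ A, c • s = f + (c - ∑ a, f a) • u := by
  have hc0 : 0 ≤ c := (Finset.sum_nonneg fun a _ => hf a).trans hc
  rcases hc0.eq_or_lt with rfl | hcpos
  · have hf0 : ∑ a, f a = 0 := le_antisymm hc (Finset.sum_nonneg fun a _ => hf a)
    have : f = 0 := (Fintype.sum_eq_zero_iff_of_nonneg hf).1 hf0
    exact ⟨u, hu, by simp [this]⟩
  · refine ⟨c⁻¹ • (f + (c - ∑ a, f a) • u), ⟨fun a => ?_, ?_⟩, smul_inv_smul₀ hcpos.ne' _⟩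
    · exact mul_nonneg (inv_nonneg.2 hc0)
        (add_nonneg (hf a) (mul_nonneg (sub_nonneg.2 hc) (hu.1 a)))
    · simp only [Pi.smul_apply, Pi.add_apply, smul_eq_mul, ← Finset.mul_sum,
        Finset.sum_add_distrib, hu.2, mul_one, add_sub_cancel, inv_mul_cancel₀ hcpos.ne']

theorem affineCost_le_of_fill_decomposition [Fintype A] [Fintype B] {S : Set (Table X Y A B)}
    {p : Table X Y A B} {R : Table X Y (Option A) (Option B)} {u s f : X → A → ℝ}
    {v t g : Y → B → ℝ} {c d : ℝ} (hc : 0 ≤ c) (hd : 0 ≤ d)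
    (hss : ∀ x y a b, (1 + c + d) * R x y (some a) (some b) = p x y a b)
    (hsn : ∀ x y a, (1 + c + d) * R x y (some a) none = f x a)
    (hns : ∀ x y b, (1 + c + d) * R x y none (some b) = g y b)
    (hnn : ∀ x y, (1 + c + d) * R x y none none = c + d - ∑ a, f x a - ∑ b, g y b)
    (hs : ∀ x, c • s x = f x + (c - ∑ a, f x a) • u x)
    (ht : ∀ y, d • t y = g y + (d - ∑ b, g y b) • v y)
    (hfill : postprocess (fillKernel u) (fillKernel v) R ∈ S) (hsv : prodTable s v ∈ S)
    (hut : prodTable u t ∈ S) : affineCost S p ≤ 1 + 2 * (c + d) := by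
  refine (affineCost_le ![1 + c + d, -c, -d]
    ![postprocess (fillKernel u) (fillKernel v) R, prodTable s v, prodTable u t] ?_ ?_).trans
    (le_of_eq ?_)
  · intro i
    fin_cases i
    exacts [hfill, hsv, hut]
  · ext x y a b
    have hsa := congrFun (hs x) a
    have htb := congrFun (ht y) b
    simp only [Pi.add_apply, Pi.smul_apply, smul_eq_mul] at hsa htb
    simp only [Fin.sum_univ_three, Matrix.cons_val_zero, Matrix.cons_val_one, Matrix.cons_val,
      Pi.add_apply, Pi.smul_apply, smul_eq_mul, postprocess_fillKernel_apply, prodTable]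
    linear_combination v y b * hsa + u x a * htb - hss x y a b - v y b * hsn x y a
      - u x a * hns x y b - u x a * v y b * hnn x y
  · simp only [Fin.sum_univ_three, Matrix.cons_val_zero, Matrix.cons_val_one, Matrix.cons_val,
      abs_neg, abs_of_nonneg hc, abs_of_nonneg hd, abs_of_nonneg (show 0 ≤ 1 + c + d by linarith)]
    ring

theorem NonSignaling.sum_none_none [Fintype A] [Fintype B] {p : Table X Y A B}
    (hp : NonSignaling p) {R : Table X Y (Option A) (Option B)} (hR : NonSignaling R) {N : ℝ}
    (hRp : ∀ x y a b, N * R x y (some a) (some b) = p x y a b) (x : X) (y : Y) :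
    N * R x y none none =
      N - 1 - ∑ a, N * R x y (some a) none - ∑ b, N * R x y none (some b) := by
  have hp1 := hp.sum_eq_one x y
  simp only [← hRp, ← Finset.mul_sum] at hp1 ⊢
  have hR1 := hR.sum_eq_one x y
  simp only [Fintype.sum_option, Finset.sum_add_distrib] at hR1
  linear_combination N * hR1 - hp1

/-- Let `N R = p` on the outcomes of `R` other than `none`. If both players replace `none` by a
sample of their marginal of `p`, then `R` becomes a distribution `P` for which `N P - p` is a
nonnegative combination of product distributions. -/
theorem affineCost_le_of_postselection [Finite X] [Nonempty X] [Nonempty Y] [Fintype A] [Fintype B]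
    {S : Set (Table X Y A B)} {p : Table X Y A B} (hp : NonSignaling p)
    {R : Table X Y (Option A) (Option B)} (hR : NonSignaling R) {N : ℝ} (hN : 0 ≤ N)
    (hRp : ∀ x y a b, N * R x y (some a) (some b) = p x y a b)
    (hS : ∀ (κ : X → Option A → A → ℝ) (η : Y → Option B → B → ℝ),
      (∀ x o, κ x o ∈ stdSimplex ℝ A) → (∀ y o, η y o ∈ stdSimplex ℝ B) → postprocess κ η R ∈ S) :
    affineCost S p ≤ 2 * N - 1 := by
  have x₀ : X := Classical.arbitrary X
  have y₀ : Y := Classical.arbitrary Y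
  obtain ⟨u, hu, hpu⟩ := hp.exists_alice_marginal
  obtain ⟨v, hv, hpv⟩ := hp.exists_bob_marginal
  obtain ⟨U, -, hRU⟩ := hR.exists_alice_marginal
  obtain ⟨V, -, hRV⟩ := hR.exists_bob_marginal
  let f : X → A → ℝ := fun x a => N * U x (some a) - u x a
  let g : Y → B → ℝ := fun y b => N * V y (some b) - v y b
  have hsn : ∀ x y a, N * R x y (some a) none = f x a := fun x y a => by
    simp only [f, ← hRU x y, ← hpu x y, ← hRp, Fintype.sum_option, ← Finset.mul_sum]
    ring
  have hns : ∀ x y b, N * R x y none (some b) = g y b := fun x y b => by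
    simp only [g, ← hRV x y, ← hpv x y, ← hRp, Fintype.sum_option, ← Finset.mul_sum]
    ring
  have hnn : ∀ x y, N * R x y none none = N - 1 - ∑ a, f x a - ∑ b, g y b := fun x y => by
    simpa only [hsn, hns] using hp.sum_none_none hR hRp x y
  have hf : ∀ x, 0 ≤ f x := fun x a => hsn x y₀ a ▸ mul_nonneg hN (hR.nonneg ..)
  have hg : ∀ y, 0 ≤ g y := fun y b => hns x₀ y b ▸ mul_nonneg hN (hR.nonneg ..)
  obtain ⟨c, d, hcd, hfc, hgd⟩ := exists_add_eq_of_forall_add_le (M := N - 1)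
    (F := fun x => ∑ a, f x a) (G := fun y => ∑ b, g y b) fun x y => by
      linarith [hnn x y, mul_nonneg hN (hR.nonneg x y none none)]
  have hc : 0 ≤ c := (Finset.sum_nonneg fun a _ => hf x₀ a).trans (hfc x₀)
  have hd : 0 ≤ d := (Finset.sum_nonneg fun b _ => hg y₀ b).trans (hgd y₀)
  choose s hs hsf using fun x => exists_mem_stdSimplex_smul_eq (hu x) (hf x) (hfc x)
  choose t ht htg using fun y => exists_mem_stdSimplex_smul_eq (hv y) (hg y) (hgd y)
  have hprod : ∀ (s : X → A → ℝ) (t : Y → B → ℝ), (∀ x, s x ∈ stdSimplex ℝ A) →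
      (∀ y, t y ∈ stdSimplex ℝ B) → prodTable s t ∈ S := fun s t hs ht =>
    postprocess_const hR.sum_eq_one s t ▸ hS _ _ (fun x _ => hs x) fun y _ => ht y
  obtain rfl : N = 1 + c + d := by linarith
  refine (affineCost_le_of_fill_decomposition hc hd hRp hsn hns (fun x y => ?_) hsf htg
    (hS _ _ (fillKernel_mem_stdSimplex hu) (fillKernel_mem_stdSimplex hv)) (hprod s v hs hv)
    (hprod u t hu ht)).trans (by linarith)
  rw [hnn]
  ring

end Postselection

/-! ### Classical protocols -/

section Classical

variable {X Y A B : Type*}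

open Classical in
/-- The kernel that keeps the outcome on the inputs satisfying `k` and aborts, with outcome `none`,
on all others. -/
def abortKernel (k : X → Prop) (x : X) (o : Option A) : Option A → ℝ :=
  Pi.single (if k x then o else none) 1

theorem abortKernel_mem_stdSimplex [Fintype A] (k : X → Prop) (x : X) (o : Option A) :
    abortKernel k x o ∈ stdSimplex ℝ (Option A) := by
  classical
  convert! single_mem_stdSimplex ℝ (if k x then o else none)

theorem abortKernel_apply_some [DecidableEq A] (k : X → Prop) [DecidablePred k] (x : X)
    (o : Option A) (a : A) : abortKernel k x o (some a) = if k x ∧ o = some a then 1 else 0 := by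
  by_cases hk : k x <;> simp [abortKernel, hk, Pi.single_apply, eq_comm]

theorem postprocess_abortKernel_apply_some [Fintype A] [Fintype B] (k : X → Prop) (l : Y → Prop)
    [DecidablePred k] [DecidablePred l] (R : Table X Y (Option A) (Option B)) (x : X) (y : Y)
    (a : A) (b : B) :
    postprocess (abortKernel k) (abortKernel l) R x y (some a) (some b) =
      if k x ∧ l y then R x y (some a) (some b) else 0 := by
  classical
  by_cases hk : k x <;> by_cases hl : l y <;>
    simp [postprocess_apply, abortKernel_apply_some, hk, hl]

theorem exists_mem_localSet_half_mul [Finite X] [Finite Y] [Finite A] [Finite B]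
    {R : Bool → Table X Y (Option A) (Option B)}
    (hR : ∀ c, R c ∈ localSet X Y (Option A) (Option B)) {bit : X → Y → Bool}
    {k : Bool → X → Prop} {l : Bool → Y → Prop} (hkl : ∀ c x y, k c x ∧ l c y ↔ bit x y = c) :
    ∃ R' ∈ localSet X Y (Option A) (Option B), ∀ x y a b,
      R' x y (some a) (some b) = 1 / 2 * R (bit x y) x y (some a) (some b) := by
  classical
  have := Fintype.ofFinite A
  have := Fintype.ofFinite B
  let R' c := postprocess (abortKernel (k c)) (abortKernel (l c)) (R c)
  have hR' : ∀ c, R' c ∈ localSet X Y (Option A) (Option B) := fun c =>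
    postprocess_mem_localSet (abortKernel_mem_stdSimplex _) (abortKernel_mem_stdSimplex _) (hR c)
  refine ⟨(1 / 2 : ℝ) • R' false + (1 / 2 : ℝ) • R' true,
    convex_convexHull ℝ _ (hR' false) (hR' true) (by norm_num) (by norm_num) (by norm_num),
    fun x y a b => ?_⟩
  simp only [Pi.add_apply, Pi.smul_apply, smul_eq_mul, R', postprocess_abortKernel_apply_some, hkl]
  cases bit x y <;> simp

open Classical in
/-- Both players guess the transcript from public coins, and a player whose bits contradict the
guess aborts. -/
theorem CProtocol.exists_postselection [Finite X] [Finite Y] [Finite A] [Finite B]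
    (P : CProtocol X Y A B) {t : ℕ} (ht : P.cost ≤ t) :
    ∃ R ∈ localSet X Y (Option A) (Option B), ∀ x y a b,
      R x y (some a) (some b) = (1 / 2) ^ t * if P.run x y = (a, b) then 1 else 0 := by
  have := Fintype.ofFinite A
  have := Fintype.ofFinite B
  induction P generalizing t with
  | output outA outB =>
    let D (o : Option (X → A)) (o' : Option (Y → B)) : Table X Y (Option A) (Option B) :=
      localDet (fun x => o.map (· x), fun y => o'.map (· y))
    have hD : ∀ o o', D o o' ∈ localSet X Y (Option A) (Option B) := fun o o' =>
      subset_convexHull ℝ _ ⟨_, rfl⟩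
    have hle : (1 / 2 : ℝ) ^ t ≤ 1 := pow_le_one₀ (by norm_num) (by norm_num)
    refine ⟨(1 / 2 : ℝ) ^ t • D (some outA) (some outB) + (1 - (1 / 2 : ℝ) ^ t) • D none none,
      convex_convexHull ℝ _ (hD _ _) (hD _ _) (by positivity) (by linarith) (by ring),
      fun x y a b => ?_⟩
    by_cases ha : outA x = a <;> by_cases hb : outB y = b <;>
      simp [D, localDet, CProtocol.run, ha, hb, eq_comm (a := a), eq_comm (a := b)]
  | aliceSends bit next ih =>
    simp only [CProtocol.cost] at ht
    obtain ⟨t, rfl⟩ : ∃ n, t = n + 1 := ⟨t - 1, by omega⟩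
    choose R hR hRrun using fun c => ih c (t := t) (by cases c <;> omega)
    obtain ⟨R', hR', hRR'⟩ := exists_mem_localSet_half_mul hR (bit := fun x _ => bit x)
      (k := fun c x => bit x = c) (l := fun _ _ => True) (by simp)
    exact ⟨R', hR', fun x y a b => by rw [hRR', hRrun, pow_succ', mul_assoc, CProtocol.run]⟩
  | bobSends bit next ih =>
    simp only [CProtocol.cost] at ht
    obtain ⟨t, rfl⟩ : ∃ n, t = n + 1 := ⟨t - 1, by omega⟩
    choose R hR hRrun using fun c => ih c (t := t) (by cases c <;> omega)
    obtain ⟨R', hR', hRR'⟩ := exists_mem_localSet_half_mul hR (bit := fun _ y => bit y)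
      (k := fun _ _ => True) (l := fun c y => bit y = c) (by simp)
    exact ⟨R', hR', fun x y a b => by rw [hRR', hRrun, pow_succ', mul_assoc, CProtocol.run]⟩

open Classical in
theorem toReal_map_apply_eq_sum {α β : Type*} [Fintype α] (μ : PMF α) (f : α → β) (b : β) :
    ((μ.map f) b).toReal = ∑ a, (μ a).toReal * if f a = b then 1 else 0 := by
  rw [PMF.map_apply, tsum_fintype, ENNReal.toReal_sum fun a _ => by
    split_ifs <;> simp [μ.apply_ne_top a]]
  refine Finset.sum_congr rfl fun a _ => ?_
  by_cases h : f a = b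
  · simp [h]
  · simp [h, Ne.symm h]

theorem sum_toReal_eq_one {α : Type*} [Fintype α] (μ : PMF α) : ∑ a, (μ a).toReal = 1 := by
  rw [← ENNReal.toReal_sum fun a _ => μ.apply_ne_top a, ← tsum_fintype (L := .unconditional _),
    μ.tsum_coe, ENNReal.toReal_one]

theorem ClassicalSim.exists_postselection [Finite X] [Finite Y] [Finite A] [Finite B] {t : ℕ}
    {p : Table X Y A B} (hp : ClassicalSim t p) :
    ∃ R ∈ localSet X Y (Option A) (Option B), ∀ x y a b,
      (2 : ℝ) ^ t * R x y (some a) (some b) = p x y a b := by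
  classical
  have := Fintype.ofFinite A
  have := Fintype.ofFinite B
  have := Fintype.ofFinite X
  have := Fintype.ofFinite Y
  obtain ⟨μ, hμ, hpμ⟩ := hp
  let ν : PMF (X → Y → A × B) := μ.map CProtocol.run
  have hν : ∀ φ, ∃ R ∈ localSet X Y (Option A) (Option B), ν φ ≠ 0 → ∀ x y a b,
      R x y (some a) (some b) = (1 / 2) ^ t * if φ x y = (a, b) then 1 else 0 := fun φ => by
    by_cases hφ : ν φ = 0
    · exact ⟨localDet (fun _ => none, fun _ => none), subset_convexHull ℝ _ ⟨_, rfl⟩,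
        fun h => absurd hφ h⟩
    · obtain ⟨P, hP, rfl⟩ := (PMF.mem_support_map_iff _ _ _).1 ((PMF.mem_support_iff _ _).2 hφ)
      obtain ⟨R, hR, hRrun⟩ := P.exists_postselection (hμ P hP)
      exact ⟨R, hR, fun _ => hRrun⟩
  choose R hR hRrun using hν
  refine ⟨∑ φ, (ν φ).toReal • R φ, (convex_convexHull ℝ _).sum_mem
    (fun φ _ => ENNReal.toReal_nonneg) (sum_toReal_eq_one ν) fun φ _ => hR φ, fun x y a b => ?_⟩
  have hmap : (μ.map fun P => P.run x y) = ν.map fun φ => φ x y := by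
    rw [PMF.map_comp]
    rfl
  rw [hpμ, hmap, toReal_map_apply_eq_sum]
  simp only [Finset.sum_apply, Pi.smul_apply, smul_eq_mul, Finset.mul_sum]
  refine Finset.sum_congr rfl fun φ _ => ?_
  by_cases hφ : ν φ = 0
  · simp [hφ]
  · have hpow : (2 : ℝ) ^ t * (1 / 2) ^ t = 1 := by rw [← mul_pow]; norm_num
    rw [hRrun φ hφ, mul_left_comm, ← mul_assoc ((2 : ℝ) ^ t), hpow, one_mul]
    congr

theorem nuTilde_le_of_classicalSim [Finite X] [Finite Y] [Fintype A] [Fintype B] [Nonempty X]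
    [Nonempty Y] {t : ℕ} {p : Table X Y A B} (hp : NonSignaling p) (hsim : ClassicalSim t p) :
    nuTilde p ≤ 2 * 2 ^ t - 1 := by
  obtain ⟨R, hR, hRp⟩ := hsim.exists_postselection
  exact affineCost_le_of_postselection hp (nonSignaling_of_mem_localSet hR) (by positivity) hRp
    fun κ η hκ hη => postprocess_mem_localSet hκ hη hR

end Classical

/-! ### Matrices of operators -/

section OperatorMatrix

/-- The Hilbert space direct sum of copies of `H`, indexed by `n`. -/
abbrev DirectSumSpace (n H : Type*) : Type _ := PiLp 2 (fun _ : n => H)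

theorem inner_single_left {H n : Type*} [NormedAddCommGroup H] [InnerProductSpace ℂ H] [Fintype n]
    [DecidableEq n] (j : n) (ψ : H) (v : DirectSumSpace n H) :
    inner ℂ (PiLp.single 2 j ψ : DirectSumSpace n H) v = inner ℂ ψ (v j) := by
  rw [PiLp.inner_apply, Finset.sum_eq_single j] <;> simp +contextual

variable (n H : Type*) [NormedAddCommGroup H] [InnerProductSpace ℂ H] [CompleteSpace H] [Fintype n]
  [DecidableEq n]

/-- A square matrix of operators on `H`, as an operator on the direct sum of copies of `H`. -/
def opMat : Matrix n n (H →L[ℂ] H) →⋆ₐ[ℂ] (DirectSumSpace n H →L[ℂ] DirectSumSpace n H) where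
  toFun M := (PiLp.continuousLinearEquiv 2 ℂ (fun _ : n => H)).symm.toContinuousLinearMap ∘L
    (ContinuousLinearMap.pi fun i => ∑ j, M i j ∘L ContinuousLinearMap.proj j) ∘L
    (PiLp.continuousLinearEquiv 2 ℂ (fun _ : n => H)).toContinuousLinearMap
  map_one' := by
    ext v i
    simp only [Matrix.one_apply, ContinuousLinearMap.comp_apply, ContinuousLinearEquiv.coe_coe,
      ContinuousLinearMap.coe_pi', sum_apply, ContinuousLinearMap.proj_apply,
      PiLp.continuousLinearEquiv_apply, PiLp.continuousLinearEquiv_symm_apply, one_apply_eq_self]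
    rw [Finset.sum_eq_single i] <;> simp +contextual [eq_comm]
  map_mul' M N := by
    ext v i
    simp only [Matrix.mul_apply, ContinuousLinearMap.comp_apply, ContinuousLinearEquiv.coe_coe,
      ContinuousLinearMap.coe_pi', sum_apply, ContinuousLinearMap.proj_apply,
      PiLp.continuousLinearEquiv_apply, mul_apply_eq_comp, PiLp.continuousLinearEquiv_symm_apply,
      map_sum]
    rw [Finset.sum_comm]
  map_zero' := by
    ext v i
    simp
  map_add' M N := by
    ext v i
    simp [Finset.sum_add_distrib]
  commutes' c := by
    ext v i
    simp only [Matrix.algebraMap_matrix_apply, Algebra.algebraMap_eq_smul_one,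
      ContinuousLinearMap.comp_apply, ContinuousLinearEquiv.coe_coe, ContinuousLinearMap.coe_pi',
      sum_apply, ContinuousLinearMap.proj_apply, PiLp.continuousLinearEquiv_apply,
      PiLp.continuousLinearEquiv_symm_apply, smul_apply, one_apply_eq_self, PiLp.smul_apply]
    rw [Finset.sum_eq_single i] <;> simp +contextual [eq_comm]
  map_star' M := by
    rw [ContinuousLinearMap.star_eq_adjoint, ContinuousLinearMap.eq_adjoint_iff]
    intro v w
    simp only [Matrix.star_apply, ContinuousLinearMap.star_eq_adjoint,
      ContinuousLinearMap.comp_apply, ContinuousLinearEquiv.coe_coe, ContinuousLinearMap.coe_pi',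
      sum_apply, ContinuousLinearMap.proj_apply, PiLp.continuousLinearEquiv_apply,
      PiLp.continuousLinearEquiv_symm_apply, PiLp.inner_apply, sum_inner,
      ContinuousLinearMap.adjoint_inner_left, inner_sum]
    rw [Finset.sum_comm]

/-- The diagonal action of an operator on the direct sum of copies of `H`. -/
def ampliation : (H →L[ℂ] H) →⋆ₐ[ℂ] (DirectSumSpace n H →L[ℂ] DirectSumSpace n H) where
  toAlgHom := (opMat n H).toAlgHom.comp
    ((Matrix.diagonalAlgHom ℂ).comp (Pi.constAlgHom ℂ n (H →L[ℂ] H)))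
  map_star' T := by
    change opMat n H (Matrix.diagonal _) = star (opMat n H (Matrix.diagonal _))
    rw [← map_star, Matrix.star_eq_conjTranspose, Matrix.diagonal_conjTranspose]
    rfl

variable {n H}

theorem opMat_apply (M : Matrix n n (H →L[ℂ] H)) (v : DirectSumSpace n H) (i : n) :
    opMat n H M v i = ∑ j, M i j (v j) := by
  change (∑ j, M i j ∘L ContinuousLinearMap.proj j : (n → H) →L[ℂ] H) v = _
  simp

theorem opMat_single (M : Matrix n n (H →L[ℂ] H)) (j : n) (ψ : H) (i : n) :
    opMat n H M (PiLp.single 2 j ψ) i = M i j ψ := by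
  rw [opMat_apply, Finset.sum_eq_single j] <;> simp +contextual

theorem ampliation_apply (T : H →L[ℂ] H) (v : DirectSumSpace n H) (i : n) :
    ampliation n H T v i = T (v i) := by
  change opMat n H (Matrix.diagonal fun _ => T) v i = _
  rw [opMat_apply, Finset.sum_eq_single i] <;> simp +contextual [eq_comm]

theorem ampliation_single (T : H →L[ℂ] H) (i : n) (ψ : H) :
    ampliation n H T (PiLp.single 2 i ψ) = PiLp.single 2 i (T ψ) := by
  ext j
  rw [ampliation_apply]
  obtain rfl | hij := eq_or_ne j i <;> simp [*]

theorem commute_ampliation_opMat {T : H →L[ℂ] H} {M : Matrix n n (H →L[ℂ] H)}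
    (hTM : ∀ i j, Commute T (M i j)) : Commute (ampliation n H T) (opMat n H M) := by
  ext v i
  simp only [mul_apply_eq_comp, ampliation_apply, opMat_apply, map_sum]
  exact Finset.sum_congr rfl fun j _ => DFunLike.congr_fun (hTM i j) (v j)

end OperatorMatrix

/-! ### Projective and generalized measurements -/

section Measurements

namespace IsProjMeas

variable {A R : Type*} [Fintype A] [Ring R] [StarRing R] {E : A → R}

theorem map {S F : Type*} [Ring S] [StarRing S] [FunLike F R S] [RingHomClass F R S]
    [StarHomClass F R S] (φ : F) (hE : IsProjMeas E) : IsProjMeas fun a => φ (E a) where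
  selfAdjoint a := by rw [← map_star, hE.selfAdjoint]
  mul_eq a a' := by rw [← map_mul, hE.mul_eq]; split_ifs <;> simp
  sum_eq_one := by rw [← map_sum, hE.sum_eq_one, map_one]

theorem conj (hE : IsProjMeas E) {U : R} (hU : U ∈ unitary R) :
    IsProjMeas fun a => star U * E a * U where
  selfAdjoint a := by simp [hE.selfAdjoint, mul_assoc]
  mul_eq a a' := by
    calc star U * E a * U * (star U * E a' * U)
        = star U * E a * (U * star U) * E a' * U := by simp only [mul_assoc]
      _ = star U * (E a * E a') * U := by
        rw [Unitary.mul_star_self_of_mem hU, mul_one, mul_assoc (star U)]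
      _ = _ := by rw [hE.mul_eq]; split_ifs <;> simp
  sum_eq_one := by
    rw [← Finset.sum_mul, ← Finset.mul_sum, hE.sum_eq_one, mul_one,
      Unitary.star_mul_self_of_mem hU]

theorem mul_self (hE : IsProjMeas E) (a : A) : E a * E a = E a := by
  rw [hE.mul_eq, if_pos rfl]

theorem nonneg [PartialOrder R] [StarOrderedRing R] (hE : IsProjMeas E) (a : A) : 0 ≤ E a := by
  have : E a = star (E a) * E a := by rw [hE.selfAdjoint, hE.mul_self]
  exact this ▸ star_mul_self_nonneg _

end IsProjMeas

open Classical in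
theorem isProjMeas_diagonal {A R n : Type*} [Fintype A] [Ring R] [StarRing R] [Fintype n]
    [DecidableEq n] (f : n → A) : IsProjMeas fun a =>
      (Matrix.diagonal fun i => if f i = a then 1 else 0 : Matrix n n R) where
  selfAdjoint a := by
    rw [Matrix.star_eq_conjTranspose, Matrix.diagonal_conjTranspose]
    congr 1
    ext i
    simp only [Pi.star_apply, apply_ite star, star_one, star_zero]
  mul_eq a a' := by
    ext i j
    simp only [Matrix.diagonal_mul_diagonal, Matrix.diagonal_apply]
    split_ifs <;> grind [Matrix.diagonal_apply, Matrix.zero_apply]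
  sum_eq_one := by
    ext i j
    rcases eq_or_ne i j with rfl | h <;> simp [Matrix.sum_apply, *]

/-- A generalized measurement: a family of positive elements, indexed by outcomes, that sums to
`1`. -/
structure IsPOVM {A R : Type*} [Fintype A] [Ring R] [PartialOrder R] (E : A → R) : Prop where
  nonneg : ∀ a, 0 ≤ E a
  sum_eq_one : ∑ a, E a = 1

theorem IsProjMeas.isPOVM {A R : Type*} [Fintype A] [Ring R] [StarRing R] [PartialOrder R]
    [StarOrderedRing R] {E : A → R} (hE : IsProjMeas E) : IsPOVM E :=
  ⟨hE.nonneg, hE.sum_eq_one⟩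

namespace IsPOVM

variable {A A' R S : Type*} [Fintype A] [Fintype A'] [Ring R] [PartialOrder R] {E : A → R}

theorem map [Ring S] [PartialOrder S] {F : Type*} [FunLike F R S] [RingHomClass F R S]
    [OrderHomClass F R S] (φ : F) (hE : IsPOVM E) : IsPOVM fun a => φ (E a) where
  nonneg a := map_nonneg φ (hE.nonneg a)
  sum_eq_one := by rw [← map_sum, hE.sum_eq_one, map_one]

theorem postprocess [IsOrderedAddMonoid R] [Module ℝ R] [PosSMulMono ℝ R] (hE : IsPOVM E)
    {κ : A → A' → ℝ} (hκ : ∀ a, κ a ∈ stdSimplex ℝ A') :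
    IsPOVM fun a' => ∑ a, κ a a' • E a where
  nonneg a' := Finset.sum_nonneg fun a _ => smul_nonneg ((hκ a).1 a') (hE.nonneg a)
  sum_eq_one := by
    rw [Finset.sum_comm]
    simp only [← Finset.sum_smul, (hκ _).2, one_smul, hE.sum_eq_one]

end IsPOVM

/-- The completion of a family of operators by an outcome `none`, so that the sum becomes `1`. -/
def completeMeas {A R : Type*} [Fintype A] [Ring R] (E : A → R) (o : Option A) : R :=
  o.elim (1 - ∑ a, E a) E

theorem isPOVM_completeMeas {A R : Type*} [Fintype A] [Ring R] [PartialOrder R]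
    [IsOrderedAddMonoid R] {E : A → R} (hE : ∀ a, 0 ≤ E a) (hE1 : ∑ a, E a ≤ 1) :
    IsPOVM (completeMeas E) where
  nonneg
    | some a => hE a
    | none => sub_nonneg.2 hE1
  sum_eq_one := by simp [Fintype.sum_option, completeMeas]

theorem commute_completeMeas {A R : Type*} [Fintype A] [Ring R] {E : A → R} {T : R}
    (hT : ∀ a, Commute (E a) T) : ∀ o, Commute (completeMeas E o) T
  | some a => hT a
  | none => (Commute.one_left T).sub_left (Commute.sum_left _ _ _ fun a _ => hT a)

/-- If `∑ c, k c * k c = 1` with self-adjoint `k c`, this is a unitary with column `none` equal to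
`k`, that is, one that extends the isometry with components `k`. -/
def dilationUnitary {n R : Type*} [DecidableEq n] [Ring R] (k : n → R) :
    Matrix (Option n) (Option n) R
  | some c, some c' => (if c = c' then 1 else 0) - k c * k c'
  | some c, none => k c
  | none, some c => -k c
  | none, none => 0

section Dilation

variable {A n R : Type*} [DecidableEq n] [Ring R] {k : n → R}

theorem dilationUnitary_mul_neg [Fintype n] (hk : ∑ c, k c * k c = 1) :
    dilationUnitary k * dilationUnitary (-k) = 1 := by
  have hkk : ∀ c d, ∑ e, k c * k e * (k e * k d) = k c * k d := fun c d => by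
    simp only [mul_assoc, ← Finset.mul_sum]
    simp only [← mul_assoc, ← Finset.sum_mul, hk, one_mul]
  have hleft : ∀ c, ∑ e, k c * k e * k e = k c := fun c => by
    simp only [mul_assoc, ← Finset.mul_sum, hk, mul_one]
  have hright : ∀ c, ∑ e, k e * (k e * k c) = k c := fun c => by
    simp only [← mul_assoc, ← Finset.sum_mul, hk, one_mul]
  ext (_ | c) (_ | d) <;>
    simp [Matrix.mul_apply, dilationUnitary, Fintype.sum_option, hk, hkk, hleft, hright,
      sub_mul, mul_sub, Matrix.one_apply, Finset.sum_sub_distrib, Finset.sum_add_distrib]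

theorem star_dilationUnitary [StarRing R] (hk : ∀ c, star (k c) = k c) :
    star (dilationUnitary k) = dilationUnitary (-k) := by
  ext (_ | c) (_ | d) <;>
    simp [Matrix.star_apply, dilationUnitary, hk, apply_ite star, eq_comm]

theorem dilationUnitary_mem_unitary [Fintype n] [StarRing R] (hk : ∀ c, star (k c) = k c)
    (hk1 : ∑ c, k c * k c = 1) : dilationUnitary k ∈ unitary (Matrix (Option n) (Option n) R) := by
  rw [Unitary.mem_iff, star_dilationUnitary hk]
  refine ⟨?_, dilationUnitary_mul_neg hk1⟩
  simpa only [neg_neg] using dilationUnitary_mul_neg (k := -k) (by simpa using hk1)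

theorem dilationUnitary_apply_mem {S : Subring R} (hk : ∀ c, k c ∈ S) (i j : Option n) :
    dilationUnitary k i j ∈ S := by
  rcases i with _ | c <;> rcases j with _ | d
  · exact S.zero_mem
  · exact S.neg_mem (hk d)
  · exact hk c
  · refine S.sub_mem ?_ (S.mul_mem (hk c) (hk d))
    split_ifs
    exacts [S.one_mem, S.zero_mem]

open Classical in
/-- The projective measurement obtained by applying the isometry with components `k` and then
reading off its index `i`, as the outcome `f i`. -/
def dilationMeas [Fintype n] [StarRing R] (f : Option n → A) (k : n → R) (a : A) :
    Matrix (Option n) (Option n) R :=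
  star (dilationUnitary k) * (Matrix.diagonal fun i => if f i = a then 1 else 0) *
    dilationUnitary k

theorem isProjMeas_dilationMeas [Fintype A] [Fintype n] [StarRing R] (f : Option n → A)
    (hk : ∀ c, star (k c) = k c) (hk1 : ∑ c, k c * k c = 1) : IsProjMeas (dilationMeas f k) :=
  (isProjMeas_diagonal f).conj (dilationUnitary_mem_unitary hk hk1)

open Classical in
theorem dilationMeas_none_none [Fintype n] [StarRing R] (f : Option n → A)
    (hk : ∀ c, star (k c) = k c) (a : A) :
    dilationMeas f k a none none = ∑ c, if f (some c) = a then k c * k c else 0 := by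
  simp [dilationMeas, Matrix.mul_apply, Matrix.diagonal_apply, Fintype.sum_option,
    dilationUnitary, star_dilationUnitary hk]

theorem dilationMeas_apply_mem [Fintype n] [StarRing R] (f : Option n → A)
    (hk : ∀ c, star (k c) = k c) {S : Subring R} (hS : ∀ c, k c ∈ S) (a : A) (i j : Option n) :
    dilationMeas f k a i j ∈ S := by
  rw [dilationMeas, star_dilationUnitary hk, Matrix.mul_apply]
  refine S.sum_mem fun l _ => S.mul_mem ?_ (dilationUnitary_apply_mem hS l j)
  rw [Matrix.mul_diagonal]
  refine S.mul_mem (dilationUnitary_apply_mem (fun c => S.neg_mem (hS c)) i l) ?_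
  split_ifs
  exacts [S.one_mem, S.zero_mem]

end Dilation

theorem exists_naimark_dilation {H X A : Type*} [NormedAddCommGroup H] [InnerProductSpace ℂ H]
    [CompleteSpace H] [Fintype A] [Nonempty A] {E : X → A → H →L[ℂ] H} (hE : ∀ x, IsPOVM (E x)) :
    ∃ (n : Type) (_ : Fintype n) (_ : DecidableEq n) (i : n)
      (P : X → A → DirectSumSpace n H →L[ℂ] DirectSumSpace n H),
      (∀ x, IsProjMeas (P x)) ∧
      (∀ T, (∀ x a, Commute (E x a) T) → ∀ x a, Commute (P x a) (ampliation n H T)) ∧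
      ∀ x a T ψ, inner ℂ (PiLp.single 2 i ψ : DirectSumSpace n H)
        ((P x a * ampliation n H T) (PiLp.single 2 i ψ)) = inner ℂ ψ ((E x a * T) ψ) := by
  classical
  let e : Fin (Fintype.card A) ≃ A := (Fintype.equivFin A).symm
  let f : Option (Fin (Fintype.card A)) → A := fun i => i.elim (Classical.arbitrary A) e
  let k x c : H →L[ℂ] H := CFC.sqrt (E x (e c))
  have hk : ∀ x c, star (k x c) = k x c := fun x c =>
    (IsSelfAdjoint.of_nonneg (CFC.sqrt_nonneg (E x (e c)))).star_eq
  have hkk : ∀ x c, k x c * k x c = E x (e c) := fun x c =>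
    CFC.sqrt_mul_sqrt_self _ ((hE x).nonneg _)
  have hk1 : ∀ x, ∑ c, k x c * k x c = 1 := fun x => by
    simp only [hkk, Equiv.sum_comp e (E x), (hE x).sum_eq_one]
  have hnone : ∀ x a, dilationMeas f (k x) a none none = E x a := fun x a => by
    rw [dilationMeas_none_none f (hk x)]
    simp only [hkk, show ∀ c, f (some c) = e c from fun _ => rfl]
    rw [Equiv.sum_comp e fun a' => if a' = a then E x a' else 0]
    simp
  refine ⟨_, inferInstance, inferInstance, none, fun x a => opMat _ H (dilationMeas f (k x) a),
    fun x => (isProjMeas_dilationMeas f (hk x) (hk1 x)).map (opMat _ H), fun T hT x a => ?_,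
    fun x a T ψ => ?_⟩
  · have hkT : ∀ c, k x c ∈ Subring.centralizer {T} := fun c => Subring.mem_centralizer_iff.2 <| by
      rintro _ rfl
      exact (Commute.cfcₙ_nnreal (hT x (e c)) NNReal.sqrt).symm
    exact (commute_ampliation_opMat fun i j => Subring.mem_centralizer_iff.1
      (dilationMeas_apply_mem f (hk x) hkT a i j) T rfl).symm
  · rw [inner_single_left, mul_apply_eq_comp, mul_apply_eq_comp, ampliation_single, opMat_single,
      hnone]

section ExpectationTable

open scoped ComplexOrder

variable {X Y A B A' B' H : Type*} [NormedAddCommGroup H] [InnerProductSpace ℂ H]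

/-- The real parts of the expectations of the products `E x a * F y b` in the state `ψ`. -/
def expectationTable (ψ : H) (E : X → A → H →L[ℂ] H) (F : Y → B → H →L[ℂ] H) : Table X Y A B :=
  fun x y a b => (inner ℂ ψ ((E x a * F y b) ψ)).re

theorem sum_expectationTable_right [Fintype B] (ψ : H) (E : X → A → H →L[ℂ] H)
    (F : Y → B → H →L[ℂ] H) (x : X) (y : Y) (a : A) :
    ∑ b, expectationTable ψ E F x y a b = (inner ℂ ψ ((E x a * ∑ b, F y b) ψ)).re := by
  simp only [expectationTable, ← Complex.re_sum, ← inner_sum, ← sum_apply, ← Finset.mul_sum]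

theorem sum_expectationTable_left [Fintype A] (ψ : H) (E : X → A → H →L[ℂ] H)
    (F : Y → B → H →L[ℂ] H) (x : X) (y : Y) (b : B) :
    ∑ a, expectationTable ψ E F x y a b = (inner ℂ ψ (((∑ a, E x a) * F y b) ψ)).re := by
  simp only [expectationTable, ← Complex.re_sum, ← inner_sum, ← sum_apply, ← Finset.sum_mul]

theorem postprocess_expectationTable [Fintype A] [Fintype B] (κ : X → A → A' → ℝ)
    (η : Y → B → B' → ℝ) (ψ : H) (E : X → A → H →L[ℂ] H) (F : Y → B → H →L[ℂ] H) :
    postprocess κ η (expectationTable ψ E F) =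
      expectationTable ψ (fun x a' => ∑ a, κ x a a' • E x a)
        fun y b' => ∑ b, η y b b' • F y b := by
  ext x y a' b'
  simp only [postprocess_apply, expectationTable, Finset.sum_mul_sum, smul_mul_smul_comm,
    sum_apply, inner_sum, Complex.re_sum, smul_apply, inner_smul_right_eq_smul, Complex.real_smul,
    Complex.re_ofReal_mul]

variable [CompleteSpace H] {ψ : H} {E : X → A → H →L[ℂ] H} {F : Y → B → H →L[ℂ] H}

theorem inner_mul_nonneg {S T : H →L[ℂ] H} (hS : 0 ≤ S) (hT : 0 ≤ T) (hST : Commute S T) (ψ : H) :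
    0 ≤ inner ℂ ψ ((S * T) ψ) :=
  ((ContinuousLinearMap.nonneg_iff_isPositive _).1 (hST.mul_nonneg hS hT)).inner_nonneg_right ψ

theorem ofReal_expectationTable (ψ : H) (hE : ∀ x a, 0 ≤ E x a) (hF : ∀ y b, 0 ≤ F y b)
    (hEF : ∀ x y a b, Commute (E x a) (F y b)) (x : X) (y : Y) (a : A) (b : B) :
    (expectationTable ψ E F x y a b : ℂ) = inner ℂ ψ ((E x a * F y b) ψ) :=
  (RCLike.nonneg_iff_exists_ofReal.1 (inner_mul_nonneg (hE x a) (hF y b) (hEF x y a b) ψ)).elim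
    fun r hr => by rw [expectationTable, ← hr.2]; rfl

variable [Fintype A] [Fintype B]

theorem nonSignaling_expectationTable (hψ : ‖ψ‖ = 1) (hE : ∀ x, IsPOVM (E x))
    (hF : ∀ y, IsPOVM (F y)) (hEF : ∀ x y a b, Commute (E x a) (F y b)) :
    NonSignaling (expectationTable ψ E F) where
  nonneg x y a b := (Complex.nonneg_iff.1
    (inner_mul_nonneg ((hE x).nonneg a) ((hF y).nonneg b) (hEF x y a b) ψ)).1
  sum_eq_one x y := by
    simp only [sum_expectationTable_right, (hF y).sum_eq_one, mul_one]
    rw [← Complex.re_sum, ← inner_sum, ← sum_apply, (hE x).sum_eq_one, one_apply_eq_self,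
      inner_self_eq_norm_sq_to_K, hψ]
    simp
  alice a x y y' := by simp only [sum_expectationTable_right, (hF _).sum_eq_one]
  bob b x x' y := by simp only [sum_expectationTable_left, (hE _).sum_eq_one]

end ExpectationTable

section QuantumSet

variable {X Y A B A' B' : Type*} [Fintype A] [Fintype B] [Fintype A'] [Fintype B']

theorem expectationTable_mem_quantumSet {H : Type} [NormedAddCommGroup H] [InnerProductSpace ℂ H]
    [CompleteSpace H] [Nonempty A] [Nonempty B] {ψ : H} (hψ : ‖ψ‖ = 1) {E : X → A → H →L[ℂ] H}
    {F : Y → B → H →L[ℂ] H} (hE : ∀ x, IsPOVM (E x)) (hF : ∀ y, IsPOVM (F y))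
    (hEF : ∀ x y a b, Commute (E x a) (F y b)) :
    expectationTable ψ E F ∈ quantumSet X Y A B := by
  obtain ⟨n, _, _, i, P, hP, hPcomm, hPE⟩ := exists_naimark_dilation hE
  have hPF : ∀ x y a b, Commute (P x a) (ampliation n H (F y b)) := fun x y a b =>
    hPcomm _ (fun x' a' => hEF x' y a' b) x a
  obtain ⟨m, _, _, j, Q, hQ, hQcomm, hQF⟩ :=
    exists_naimark_dilation fun y => (hF y).map (ampliation n H)
  have hQP : ∀ x y a b, Commute (Q y b) (ampliation m (DirectSumSpace n H) (P x a)) :=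
    fun x y a b => hQcomm _ (fun y' b' => (hPF x y' a b').symm) y b
  refine ⟨DirectSumSpace m (DirectSumSpace n H), inferInstance, inferInstance, inferInstance,
    PiLp.single 2 j (PiLp.single 2 i ψ), fun x a => ampliation m (DirectSumSpace n H) (P x a), Q,
    by simpa using hψ, fun x => (hP x).map (ampliation m (DirectSumSpace n H)), hQ,
    fun x y a b => (hQP x y a b).symm, fun x y a b => ?_⟩
  rw [← (hQP x y a b).eq, hQF, ← (hPF x y a b).eq, hPE,
    ofReal_expectationTable ψ (fun x => (hE x).nonneg) (fun y => (hF y).nonneg) hEF]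

theorem exists_expectationTable_of_mem_quantumSet {p : Table X Y A B}
    (hp : p ∈ quantumSet X Y A B) :
    ∃ (H : Type) (_ : NormedAddCommGroup H) (_ : InnerProductSpace ℂ H) (_ : CompleteSpace H)
      (ψ : H) (E : X → A → H →L[ℂ] H) (F : Y → B → H →L[ℂ] H),
      ‖ψ‖ = 1 ∧ (∀ x, IsProjMeas (E x)) ∧ (∀ y, IsProjMeas (F y)) ∧
      (∀ x y a b, Commute (E x a) (F y b)) ∧ p = expectationTable ψ E F := by
  obtain ⟨H, _, _, _, ψ, E, F, hψ, hE, hF, hEF, hp⟩ := hp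
  refine ⟨H, _, _, ‹_›, ψ, E, F, hψ, hE, hF, hEF, ?_⟩
  ext x y a b
  rw [expectationTable, ← hp, Complex.ofReal_re]

theorem nonSignaling_of_mem_quantumSet {p : Table X Y A B} (hp : p ∈ quantumSet X Y A B) :
    NonSignaling p := by
  obtain ⟨H, _, _, _, ψ, E, F, hψ, hE, hF, hEF, rfl⟩ := exists_expectationTable_of_mem_quantumSet hp
  exact nonSignaling_expectationTable hψ (fun x => (hE x).isPOVM) (fun y => (hF y).isPOVM) hEF

theorem postprocess_mem_quantumSet [Nonempty A'] [Nonempty B'] {κ : X → A → A' → ℝ}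
    {η : Y → B → B' → ℝ} (hκ : ∀ x a, κ x a ∈ stdSimplex ℝ A')
    (hη : ∀ y b, η y b ∈ stdSimplex ℝ B') {R : Table X Y A B} (hR : R ∈ quantumSet X Y A B) :
    postprocess κ η R ∈ quantumSet X Y A' B' := by
  obtain ⟨H, _, _, _, ψ, E, F, hψ, hE, hF, hEF, rfl⟩ := exists_expectationTable_of_mem_quantumSet hR
  rw [postprocess_expectationTable]
  refine expectationTable_mem_quantumSet hψ (fun x => (hE x).isPOVM.postprocess (hκ x))
    (fun y => (hF y).isPOVM.postprocess (hη y)) fun x y a' b' => ?_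
  exact Commute.sum_left _ _ _ fun a _ => Commute.sum_right _ _ _ fun b _ =>
    ((hEF x y a b).smul_left _).smul_right _

end QuantumSet

end Measurements

/-! ### Linking the operators of the two players -/

section Link

variable {q : ℕ} {H : Type*} [NormedAddCommGroup H] [InnerProductSpace ℂ H]

/-- The permutation of the configurations that exchanges the bits of `s` and `t`, in each
position. -/
def swapPerm (s t : Fin q → Bool) : Equiv.Perm (Fin q → Bool) :=
  Equiv.piCongrRight fun i => Equiv.swap (s i) (t i)

theorem swapPerm_apply (s t u : Fin q → Bool) (i : Fin q) :
    swapPerm s t u i = if u i = s i then t i else if u i = t i then s i else u i :=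
  Equiv.swap_apply_def _ _ _

/-- The configuration that agrees with `r` where `c` holds, and with `s` elsewhere. -/
def merge (c : Fin q → Bool) (r s : Fin q → Bool) : Fin q → Bool :=
  fun i => if c i then r i else s i

/-- The amplitudes of the state obtained by linking an operator `P` of the player who sends the
qubits where `c` holds with an operator `Q` of the other player. Every qubit starts in `|0⟩`, is
first acted on by its sender, and then, from the configuration `r` on, by its receiver. -/
def link (c : Fin q → Bool) (P Q : QOp q H) (f : Fin q → Bool) : H →L[ℂ] H :=
  ∑ r, P (merge c r f) (merge c (fun _ => false) r) * Q (merge c f r) (merge c r fun _ => false)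

theorem link_one (c : Fin q → Bool) (f : Fin q → Bool) :
    link c (1 : QOp q H) 1 f = (1 : QOp q H) f fun _ => false := by
  have hr : ∀ r, (merge c r f = merge c (fun _ => false) r ∧
      merge c f r = merge c r fun _ => false) ↔ r = (fun _ => false) ∧ f = fun _ => false :=
    fun r => by
      simp only [funext_iff, merge, ← forall_and]
      exact forall_congr' fun i => by grind
  simp only [link, Matrix.one_apply, ite_zero_mul_ite_zero, mul_one, hr]
  simp [ite_and]

variable [CompleteSpace H] {𝒜 ℬ : StarSubalgebra ℂ (H →L[ℂ] H)} {S T : Set (Fin q)}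
  {M N : QOp q H}

namespace ActsOn

theorem apply_congr (hM : ActsOn 𝒜 S M) {s t s' t' : Fin q → Bool}
    (hS : ∀ i ∈ S, s i = s' i ∧ t i = t' i) (hSc : ∀ i, i ∉ S → (s i = t i ↔ s' i = t' i)) :
    M s t = M s' t' := by
  by_cases hst : ∃ i, i ∉ S ∧ s i ≠ t i
  · obtain ⟨i, hi, hne⟩ := hst
    rw [hM.eq_zero s t ⟨i, hi, hne⟩, hM.eq_zero s' t' ⟨i, hi, fun h => hne ((hSc i hi).2 h)⟩]
  · push Not at hst
    exact hM.eq_of_agree s t s' t' hS fun i hi => ⟨hst i hi, (hSc i hi).1 (hst i hi)⟩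

theorem mono (hM : ActsOn 𝒜 S M) (hST : S ⊆ T) : ActsOn 𝒜 T M where
  mem := hM.mem
  eq_zero s t := fun ⟨i, hi, hne⟩ => hM.eq_zero s t ⟨i, fun hS => hi (hST hS), hne⟩
  eq_of_agree s t s' t' hT hTc := hM.apply_congr (fun i hi => hT i (hST hi)) fun i _ => by
    by_cases hi : i ∈ T
    · rw [(hT i hi).1, (hT i hi).2]
    · exact iff_of_true (hTc i hi).1 (hTc i hi).2

theorem one (𝒜 : StarSubalgebra ℂ (H →L[ℂ] H)) (S : Set (Fin q)) :
    ActsOn 𝒜 S (1 : QOp q H) where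
  mem s t := by
    rw [Matrix.one_apply]
    split_ifs
    exacts [one_mem 𝒜, zero_mem 𝒜]
  eq_zero s t := fun ⟨i, _, hne⟩ => Matrix.one_apply_ne fun h => hne (congrFun h i)
  eq_of_agree s t s' t' hS hSc := by
    have : s = t ↔ s' = t' := by
      simp only [funext_iff]
      exact forall_congr' fun i => by grind
    simp only [Matrix.one_apply, this]

theorem mul (hM : ActsOn 𝒜 S M) (hN : ActsOn 𝒜 S N) : ActsOn 𝒜 S (M * N) where
  mem s t := by
    rw [Matrix.mul_apply]
    exact sum_mem fun u _ => mul_mem (hM.mem s u) (hN.mem u t)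
  eq_zero s t := fun ⟨i, hi, hne⟩ => by
    rw [Matrix.mul_apply]
    refine Finset.sum_eq_zero fun u _ => ?_
    by_cases hu : s i = u i
    · rw [hN.eq_zero u t ⟨i, hi, by rwa [← hu]⟩, mul_zero]
    · rw [hM.eq_zero s u ⟨i, hi, hu⟩, zero_mul]
  eq_of_agree s t s' t' hS hSc := by
    classical
    rw [Matrix.mul_apply, Matrix.mul_apply]
    refine Fintype.sum_equiv (swapPerm s (S.piecewise s s')) _ _ fun u => ?_
    congr 1
    · apply hM.apply_congr <;> intro i hi <;> simp only [swapPerm_apply, Set.piecewise] <;> grind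
    · apply hN.apply_congr <;> intro i hi <;> simp only [swapPerm_apply, Set.piecewise] <;> grind

theorem list_prod {l : List (QOp q H)} (hl : ∀ M ∈ l, ActsOn 𝒜 S M) : ActsOn 𝒜 S l.prod :=
  List.prod_induction (ActsOn 𝒜 S) (fun _ _ => mul) (one 𝒜 S) hl

theorem commute (hcomm : ∀ S ∈ 𝒜, ∀ T ∈ ℬ, S * T = T * S) (hST : Disjoint S T)
    (hM : ActsOn 𝒜 S M) (hN : ActsOn ℬ T N) : Commute M N := by
  ext1 s t
  rw [Matrix.mul_apply, Matrix.mul_apply]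
  refine Fintype.sum_equiv (swapPerm s t) _ _ fun u => ?_
  rw [← hcomm _ (hM.mem _ _) _ (hN.mem _ _)]
  have hdisj : ∀ i, i ∈ S → i ∉ T := fun i hS hT => Set.disjoint_left.1 hST hS hT
  by_cases hu : (∀ i, i ∉ S → s i = u i) ∧ ∀ i, i ∉ T → u i = t i
  · congr 1
    · apply hM.apply_congr <;> intro i hi <;> simp only [swapPerm_apply] <;> grind
    · apply hN.apply_congr <;> intro i hi <;> simp only [swapPerm_apply] <;> grind
  · rw [not_and_or] at hu
    push Not at hu
    rcases hu with ⟨i, hi, hne⟩ | ⟨i, hi, hne⟩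
    · rw [hM.eq_zero s u ⟨i, hi, hne⟩, hM.eq_zero _ t ⟨i, hi, ?_⟩, zero_mul, zero_mul]
      simp only [swapPerm_apply]; grind
    · rw [hN.eq_zero u t ⟨i, hi, hne⟩, hN.eq_zero s _ ⟨i, hi, ?_⟩, mul_zero, mul_zero]
      simp only [swapPerm_apply]; grind

end ActsOn

theorem link_not (hcomm : ∀ S ∈ 𝒜, ∀ T ∈ ℬ, S * T = T * S) (c : Fin q → Bool) {P Q : QOp q H}
    (hP : ∀ s t, P s t ∈ 𝒜) (hQ : ∀ s t, Q s t ∈ ℬ) (f : Fin q → Bool) :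
    link (fun i => !c i) Q P f = link c P Q f := by
  have hmerge : ∀ s t, merge (fun i => !c i) s t = merge c t s := fun s t => by
    ext i
    simp only [merge]
    grind
  refine Finset.sum_congr rfl fun r _ => ?_
  simp only [hmerge]
  rw [hcomm _ (hP _ _) _ (hQ _ _)]

/-- A qubit that the second player leaves alone may be given to either player. -/
theorem link_congr_of_actsOn_compl {D : Set (Fin q)} {c c' : Fin q → Bool}
    (hc : ∀ i ∈ D, c i = true) (hc' : ∀ i ∈ D, c' i = false) (hcc' : ∀ i, i ∉ D → c i = c' i)
    (P : QOp q H) {Q : QOp q H} (hQ : ActsOn ℬ Dᶜ Q) (f : Fin q → Bool) :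
    link c P Q f = link c' P Q f := by
  classical
  refine Fintype.sum_equiv (swapPerm (D.piecewise f fun _ => false) fun _ => false) _ _ fun r => ?_
  by_cases hr : ∀ i ∈ D, f i = r i
  · congr 1
    · congr 1 <;> ext i <;> simp only [merge, swapPerm_apply, Set.piecewise] <;> grind
    · apply hQ.apply_congr <;> intro i hi <;>
        simp only [merge, swapPerm_apply, Set.piecewise] <;> grind
  · push Not at hr
    obtain ⟨i, hi, hne⟩ := hr
    rw [hQ.eq_zero _ _ ⟨i, not_not.2 hi, ?_⟩, hQ.eq_zero _ _ ⟨i, not_not.2 hi, ?_⟩, mul_zero,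
      mul_zero]
    all_goals simp only [merge, swapPerm_apply, Set.piecewise]; grind

theorem link_mul_of_actsOn_received {c : Fin q → Bool} {U : QOp q H}
    (hU : ActsOn 𝒜 {i | c i = false} U) (P Q : QOp q H) (f : Fin q → Bool) :
    link c (U * P) Q f = ∑ t, U f t * link c P Q t := by
  simp only [link, Matrix.mul_apply, Finset.sum_mul, Finset.mul_sum]
  conv_rhs => rw [Finset.sum_comm]
  refine Finset.sum_congr rfl fun r _ =>
    Fintype.sum_equiv (swapPerm r (merge c f r)) _ _ fun u => ?_
  rw [mul_assoc]
  by_cases hu : ∀ i, c i = true → r i = u i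
  · congr 1
    · apply hU.apply_congr <;> intro i hi <;> simp only [merge, swapPerm_apply] <;> grind
    · congr 2 <;> ext i <;> simp only [merge, swapPerm_apply] <;> grind
  · push Not at hu
    obtain ⟨i, hi, hne⟩ := hu
    rw [hU.eq_zero _ _ ⟨i, by simp [hi], ?_⟩, hU.eq_zero _ _ ⟨i, by simp [hi], ?_⟩, zero_mul,
      zero_mul]
    all_goals simp only [merge, swapPerm_apply]; grind

theorem link_mul_left {c : Fin q → Bool} {D : Set (Fin q)} (hD : ∀ i ∈ D, c i = true)
    {U Q : QOp q H} (hU : ActsOn 𝒜 ({i | c i = false} ∪ D) U) (hQ : ActsOn ℬ Dᶜ Q) (P : QOp q H)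
    (f : Fin q → Bool) : link c (U * P) Q f = ∑ t, U f t * link c P Q t := by
  classical
  let c' : Fin q → Bool := fun i => if i ∈ D then false else c i
  have hlink : ∀ P f, link c P Q f = link c' P Q f := fun P =>
    link_congr_of_actsOn_compl hD (fun i hi => if_pos hi) (fun i hi => (if_neg hi).symm) P hQ
  have hU' : ActsOn 𝒜 {i | c' i = false} U := hU.mono fun i hi => by
    simp only [Set.mem_ofPred_eq, c']
    grind
  simp only [hlink, link_mul_of_actsOn_received hU']

theorem link_mul_right (hcomm : ∀ S ∈ 𝒜, ∀ T ∈ ℬ, S * T = T * S) {c : Fin q → Bool}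
    {D : Set (Fin q)} (hD : ∀ i ∈ D, c i = false) {P Q U : QOp q H} (hP : ActsOn 𝒜 Dᶜ P)
    (hU : ActsOn ℬ ({i | c i = true} ∪ D) U) (hQ : ∀ s t, Q s t ∈ ℬ) (f : Fin q → Bool) :
    link c P (U * Q) f = ∑ t, U f t * link c P Q t := by
  have hUQ : ∀ s t, (U * Q) s t ∈ ℬ := fun s t => by
    rw [Matrix.mul_apply]
    exact sum_mem fun u _ => mul_mem (hU.mem s u) (hQ u t)
  rw [← link_not hcomm c hP.mem hUQ]
  simp only [← link_not hcomm c hP.mem hQ]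
  refine link_mul_left (fun i hi => ?_) (hU.mono fun i hi => ?_) hP Q f
  · rw [hD i hi, Bool.not_false]
  · simpa using hi

end Link

namespace QProtocol

variable {X Y A B : Type*} [Fintype A] [Fintype B] {q : ℕ} {H : Type*}
  [NormedAddCommGroup H] [InnerProductSpace ℂ H] [CompleteSpace H] (π : QProtocol X Y A B q H)

/-- Whether Alice is the sender of a qubit, as a bit. -/
def fromAlice (i : Fin q) : Bool :=
  match π.sender i with
  | .alice => true
  | .bob => false

theorem fromAlice_eq_true_iff (i : Fin q) : π.fromAlice i = true ↔ π.sender i = .alice := by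
  unfold fromAlice
  cases π.sender i <;> simp

theorem fromAlice_eq_false_iff (i : Fin q) : π.fromAlice i = false ↔ π.sender i = .bob := by
  unfold fromAlice
  cases π.sender i <;> simp

/-- The product of Alice's operators in the rounds of the list `l`; the last one acts first. -/
def partA (x : X) (l : List (Fin q)) : QOp q H :=
  (l.map fun i => if π.fromAlice i then π.opA x i else 1).prod

/-- The product of Bob's operators in the rounds of the list `l`; the last one acts first. -/
def partB (y : Y) (l : List (Fin q)) : QOp q H :=
  (l.map fun i => if π.fromAlice i then 1 else π.opB y i).prod

theorem partA_mem_unitary (x : X) (l : List (Fin q)) : π.partA x l ∈ unitary (QOp q H) := by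
  refine Submonoid.list_prod_mem _ (List.forall_mem_map.2 fun i _ => ?_)
  split_ifs with h
  exacts [π.opA_unitary x i ((π.fromAlice_eq_true_iff i).1 h), one_mem _]

theorem partB_mem_unitary (y : Y) (l : List (Fin q)) : π.partB y l ∈ unitary (QOp q H) := by
  refine Submonoid.list_prod_mem _ (List.forall_mem_map.2 fun i _ => ?_)
  split_ifs with h
  exacts [one_mem _, π.opB_unitary y i ((π.fromAlice_eq_false_iff i).1 (by simpa using h))]

theorem actsOn_partA (x : X) {l : List (Fin q)} {S : Set (Fin q)} (hS : ∀ i ∈ l, ∀ j ≤ i, j ∈ S) :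
    ActsOn π.algA S (π.partA x l) := by
  refine ActsOn.list_prod (List.forall_mem_map.2 fun i hi => ?_)
  split_ifs with h
  · refine (π.opA_acts x i ((π.fromAlice_eq_true_iff i).1 h)).mono ?_
    rintro j (⟨hj, -⟩ | rfl)
    exacts [hS i hi j hj.le, hS j hi j le_rfl]
  · exact ActsOn.one _ _

theorem actsOn_partB (y : Y) {l : List (Fin q)} {S : Set (Fin q)} (hS : ∀ i ∈ l, ∀ j ≤ i, j ∈ S) :
    ActsOn π.algB S (π.partB y l) := by
  refine ActsOn.list_prod (List.forall_mem_map.2 fun i hi => ?_)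
  split_ifs with h
  · exact ActsOn.one _ _
  · refine (π.opB_acts y i ((π.fromAlice_eq_false_iff i).1 (by simpa using h))).mono ?_
    rintro j (⟨hj, -⟩ | rfl)
    exacts [hS i hi j hj.le, hS j hi j le_rfl]

theorem actsOn_measA (x : X) (a : A) :
    ActsOn π.algA {i | π.fromAlice i = false} (π.measA x a) :=
  (π.measA_acts x a).mono fun i hi => (π.fromAlice_eq_false_iff i).2 hi

theorem actsOn_measB (y : Y) (b : B) :
    ActsOn π.algB {i | π.fromAlice i = true} (π.measB y b) :=
  (π.measB_acts y b).mono fun i hi => (π.fromAlice_eq_true_iff i).2 hi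

theorem prod_roundOp_apply (x : X) (y : Y) {l : List (Fin q)} (hl : l.Pairwise (· > ·))
    (f : Fin q → Bool) : (l.map (π.roundOp x y)).prod f (fun _ => false) =
      link π.fromAlice (π.partA x l) (π.partB y l) f := by
  induction l generalizing f with
  | nil => exact (link_one _ _).symm
  | cons i l ih =>
    obtain ⟨hi, hl⟩ := List.pairwise_cons.1 hl
    have hlt : ∀ k ∈ l, ∀ j ≤ k, j ∈ ({i}ᶜ : Set (Fin q)) := fun k hk j hj =>
      (hj.trans_lt (hi k hk)).ne
    have hA := π.actsOn_partA x hlt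
    have hB := π.actsOn_partB y hlt
    rw [List.map_cons, List.prod_cons, Matrix.mul_apply]
    simp only [ih hl]
    cases hs : π.sender i with
    | alice =>
      have hc := (π.fromAlice_eq_true_iff i).2 hs
      simp only [partA, partB, List.map_cons, List.prod_cons, hc, if_true, one_mul, roundOp, hs]
      refine (link_mul_left (by simpa) ((π.opA_acts x i hs).mono ?_) hB _ f).symm
      exact Set.union_subset_union_left _ fun j hj => (π.fromAlice_eq_false_iff j).2 hj.2
    | bob =>
      have hc := (π.fromAlice_eq_false_iff i).2 hs
      simp only [partA, partB, List.map_cons, List.prod_cons, hc, Bool.false_eq_true, if_false,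
        one_mul, roundOp, hs]
      refine (link_mul_right π.commute (by simpa) hA ((π.opB_acts y i hs).mono ?_) hB.mem f).symm
      exact Set.union_subset_union_left _ fun j hj => (π.fromAlice_eq_true_iff j).2 hj.2

/-- Alice's operators in all rounds, followed by her measurement with outcome `a`. -/
def finalA (x : X) (a : A) : QOp q H := π.measA x a * π.partA x (List.finRange q).reverse

/-- Bob's operators in all rounds, followed by his measurement with outcome `b`. -/
def finalB (y : Y) (b : B) : QOp q H := π.measB y b * π.partB y (List.finRange q).reverse

theorem actsOn_univ_finalA (x : X) (a : A) : ActsOn π.algA Set.univ (π.finalA x a) :=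
  ((π.measA_acts x a).mono (Set.subset_univ _)).mul
    (π.actsOn_partA x fun _ _ _ _ => Set.mem_univ _)

theorem actsOn_univ_finalB (y : Y) (b : B) : ActsOn π.algB Set.univ (π.finalB y b) :=
  ((π.measB_acts y b).mono (Set.subset_univ _)).mul
    (π.actsOn_partB y fun _ _ _ _ => Set.mem_univ _)

theorem meas_mul_totalOp_apply (x : X) (y : Y) (a : A) (b : B) (f : Fin q → Bool) :
    (π.measA x a * (π.measB y b * π.totalOp x y)) f (fun _ => false) =
      link π.fromAlice (π.finalA x a) (π.finalB y b) f := by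
  have hsort : (List.finRange q).reverse.Pairwise (· > ·) :=
    List.pairwise_reverse.2 (List.pairwise_lt_finRange q)
  have htotal : ∀ g, π.totalOp x y g (fun _ => false) = link π.fromAlice
      (π.partA x (List.finRange q).reverse) (π.partB y (List.finRange q).reverse) g := fun g => by
    rw [← prod_roundOp_apply π x y hsort, totalOp, List.ofFn_eq_map, List.map_reverse]
  have hA := π.actsOn_partA x (l := (List.finRange q).reverse) (S := ∅ᶜ) (by simp)
  have hB := π.actsOn_partB y (l := (List.finRange q).reverse) (S := Set.univ) (by simp)
  have hmeasB : ∀ g, (π.measB y b * π.totalOp x y) g (fun _ => false) = link π.fromAlice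
      (π.partA x (List.finRange q).reverse) (π.finalB y b) g := fun g => by
    rw [Matrix.mul_apply, finalB, link_mul_right π.commute (D := ∅) (by simp) hA
      ((π.actsOn_measB y b).mono Set.subset_union_left) hB.mem]
    simp only [htotal]
  rw [Matrix.mul_apply, finalA, link_mul_left (D := ∅) (by simp)
    ((π.actsOn_measA x a).mono Set.subset_union_left)
    ((π.actsOn_univ_finalB y b).mono (by simp))]
  simp only [hmeasB]

theorem prob_eq_sum (x : X) (y : Y) (a : A) (b : B) : π.prob x y a b =
    ((∑ f, ‖link π.fromAlice (π.finalA x a) (π.finalB y b) f π.ψ‖ ^ 2 : ℝ) : ℂ) := by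
  have hdisj : Disjoint {i | π.fromAlice i = false} {i | π.fromAlice i = true} :=
    Set.disjoint_left.2 fun i (hi : _ = _) (hi' : _ = _) => by simp [hi] at hi'
  have hcomm : Commute (π.measA x a) (π.measB y b) :=
    ActsOn.commute π.commute hdisj (π.actsOn_measA x a) (π.actsOn_measB y b)
  obtain ⟨P, hP⟩ : ∃ P, π.measA x a * π.measB y b = P := ⟨_, rfl⟩
  have hstar : star P = P := by
    rw [← hP, star_mul, (π.measA_proj x).selfAdjoint, (π.measB_proj y).selfAdjoint, hcomm.eq]
  have hPP : P * P = P := by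
    rw [← hP, hcomm.symm.mul_mul_mul_comm, (π.measA_proj x).mul_self, (π.measB_proj y).mul_self]
  have hsq : star (π.totalOp x y) * P * π.totalOp x y =
      star (P * π.totalOp x y) * (P * π.totalOp x y) := by
    rw [star_mul, hstar, ← mul_assoc, mul_assoc (star _) P P, hPP]
  rw [prob, hP, hsq, Matrix.mul_apply, sum_apply, inner_sum]
  push_cast
  refine Finset.sum_congr rfl fun f _ => ?_
  rw [← meas_mul_totalOp_apply, ← mul_assoc, hP]
  change inner ℂ π.ψ (ContinuousLinearMap.adjoint ((P * π.totalOp x y) f _)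
    ((P * π.totalOp x y) f _ π.ψ)) = _
  rw [ContinuousLinearMap.adjoint_inner_right, inner_self_eq_norm_sq_to_K]
  rfl

end QProtocol

/-! ### Combs -/

section Gram

variable {m n K : Type*} [Fintype m] [Fintype n] [NormedAddCommGroup K] [InnerProductSpace ℂ K]

theorem norm_sum_sq_le_card_mul_sum_norm_sq {ι E : Type*} [Fintype ι] [SeminormedAddCommGroup E]
    (v : ι → E) : ‖∑ i, v i‖ ^ 2 ≤ Fintype.card ι * ∑ i, ‖v i‖ ^ 2 :=
  calc ‖∑ i, v i‖ ^ 2 ≤ (∑ i, ‖v i‖) ^ 2 := by gcongr; exact norm_sum_le _ _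
    _ ≤ _ := sq_sum_le_card_mul_sum_sq

theorem nonneg_of_inner_eq_ofReal {T : K →L[ℂ] K} {Q : K → ℝ} (hQ : ∀ v, 0 ≤ Q v)
    (hT : ∀ v, inner ℂ v (T v) = (Q v : ℂ)) : 0 ≤ T := by
  rw [ContinuousLinearMap.nonneg_iff_isPositive, ContinuousLinearMap.isPositive_iff_complex]
  intro v
  rw [← inner_conj_symm, hT, Complex.conj_ofReal, RCLike.re_to_complex, Complex.ofReal_re]
  exact ⟨rfl, hQ v⟩

variable [CompleteSpace K]

theorem ofReal_sum_norm_sq_eq_sum_inner (M : Matrix m n (K →L[ℂ] K)) (w : n → K) :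
    ((∑ r, ‖∑ h, M r h (w h)‖ ^ 2 : ℝ) : ℂ) =
      ∑ h', ∑ h, inner ℂ (w h') ((M.conjTranspose * M) h' h (w h)) := by
  have hterm : ∀ r, ((‖∑ h, M r h (w h)‖ ^ 2 : ℝ) : ℂ) =
      ∑ h', ∑ h, inner ℂ (w h') ((star (M r h') * M r h) (w h)) := fun r => by
    rw [Complex.ofReal_pow]
    refine (inner_self_eq_norm_sq_to_K (𝕜 := ℂ) (∑ h, M r h (w h))).symm.trans ?_
    simp only [sum_inner, inner_sum, mul_apply_eq_comp,
      ContinuousLinearMap.star_eq_adjoint, ContinuousLinearMap.adjoint_inner_right]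
    exact Finset.sum_comm
  simp only [Complex.ofReal_sum, hterm, Matrix.mul_apply, Matrix.conjTranspose_apply, sum_apply,
    inner_sum]
  rw [Finset.sum_comm]
  exact Finset.sum_congr rfl fun h' _ => Finset.sum_comm

theorem inner_opMat_conjTranspose_mul_self [DecidableEq n] (M : Matrix m n (K →L[ℂ] K))
    (v : DirectSumSpace n K) : inner ℂ v (opMat n K (M.conjTranspose * M) v) =
      ((∑ r, ‖∑ h, M r h (v h)‖ ^ 2 : ℝ) : ℂ) := by
  rw [ofReal_sum_norm_sq_eq_sum_inner, PiLp.inner_apply]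
  simp only [opMat_apply, inner_sum]

end Gram

/-- A party that receives a register `β`, sends a register `α`, and is left with an outcome in
`A` and the register `β`. It is described by an isometry, whose block `L a (k, g) h` belongs to
the received state `h`, the sent state `k`, the outcome `a` and the final state `g`. -/
def IsComb {A α β K : Type*} [Fintype A] [Fintype α] [Fintype β] [DecidableEq β]
    [NormedAddCommGroup K] [InnerProductSpace ℂ K] [CompleteSpace K]
    (L : A → Matrix (α × β) β (K →L[ℂ] K)) : Prop :=
  ∑ a, (L a).conjTranspose * L a = 1

/-- The blocks of a comb with the sent register regrouped with the received one, as a map from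
both of them to the final register. -/
def bend {α β R : Type*} (V : Matrix (α × β) β R) : Matrix β (α × β) R :=
  Matrix.of fun g r => V (r.1, g) r.2

/-- The positive operator on the sent and the received register that stands for an outcome of a
comb, normalized so that the sum over the outcomes is at most `1`. -/
def combMat {α β K : Type*} [Fintype α] [Fintype β] [NormedAddCommGroup K]
    [InnerProductSpace ℂ K] [CompleteSpace K] (V : Matrix (α × β) β (K →L[ℂ] K)) :
    Matrix (α × β) (α × β) (K →L[ℂ] K) :=
  (Fintype.card α : ℂ)⁻¹ • ((bend V).conjTranspose * bend V)

theorem isComb_submatrix_of_isProjMeas {A α β σ K : Type*} [Fintype A] [Fintype α] [Fintype β]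
    [DecidableEq β] [Fintype σ] [DecidableEq σ] [NormedAddCommGroup K] [InnerProductSpace ℂ K]
    [CompleteSpace K] {M : A → Matrix σ σ (K →L[ℂ] K)} (hM : IsProjMeas M)
    {W : Matrix σ σ (K →L[ℂ] K)} (hW : W ∈ unitary (Matrix σ σ (K →L[ℂ] K))) (e : α × β ≃ σ)
    {j : β → σ} (hj : Function.Injective j) : IsComb fun a => (M a * W).submatrix e j := by
  have hsum : ∑ a, (M a * W).conjTranspose * (M a * W) = 1 :=
    calc ∑ a, star (M a * W) * (M a * W) = ∑ a, star W * M a * W := by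
          refine Finset.sum_congr rfl fun a _ => ?_
          rw [star_mul, hM.selfAdjoint, mul_assoc, ← mul_assoc (M a), hM.mul_self, mul_assoc]
      _ = 1 := by
          rw [← Finset.sum_mul, ← Finset.mul_sum, hM.sum_eq_one, mul_one,
            Unitary.star_mul_self_of_mem hW]
  simp only [IsComb, Matrix.conjTranspose_submatrix, Matrix.submatrix_mul_equiv]
  rw [← Matrix.submatrix_one j hj, ← hsum]
  ext1 h' h
  simp only [Matrix.sum_apply, Matrix.submatrix_apply]

section Comb

variable {A α β K : Type*} [Fintype α] [Fintype β] [NormedAddCommGroup K]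
  [InnerProductSpace ℂ K] [CompleteSpace K]

theorem combMat_map {K' : Type*} [NormedAddCommGroup K'] [InnerProductSpace ℂ K']
    [CompleteSpace K'] (φ : (K →L[ℂ] K) →⋆ₐ[ℂ] (K' →L[ℂ] K')) (V : Matrix (α × β) β (K →L[ℂ] K)) :
    combMat (V.map φ) = (combMat V).map φ := by
  ext1 r' r
  simp only [combMat, Matrix.smul_apply, Matrix.map_apply, Matrix.mul_apply, bend,
    Matrix.conjTranspose_apply, Matrix.of_apply, map_smul, map_sum, map_mul,
    map_star]

theorem combMat_mem {𝒜 : StarSubalgebra ℂ (K →L[ℂ] K)} {V : Matrix (α × β) β (K →L[ℂ] K)}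
    (hV : ∀ r h, V r h ∈ 𝒜) (r' r : α × β) : combMat V r' r ∈ 𝒜 := by
  rw [combMat, Matrix.smul_apply, Matrix.mul_apply]
  exact 𝒜.smul_mem (sum_mem fun g _ => mul_mem (star_mem (hV _ _)) (hV _ _)) _

theorem inner_opMat_combMat [DecidableEq α] [DecidableEq β] (V : Matrix (α × β) β (K →L[ℂ] K))
    (v : DirectSumSpace (α × β) K) : inner ℂ v (opMat (α × β) K (combMat V) v) =
      (((Fintype.card α : ℝ)⁻¹ * ∑ g, ‖∑ r : α × β, V (r.1, g) r.2 (v r)‖ ^ 2 : ℝ) : ℂ) := by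
  rw [combMat, map_smul, smul_apply, inner_smul_right, inner_opMat_conjTranspose_mul_self]
  push_cast
  rfl

theorem opMat_combMat_nonneg [DecidableEq α] [DecidableEq β]
    (V : Matrix (α × β) β (K →L[ℂ] K)) : 0 ≤ opMat (α × β) K (combMat V) := by
  refine nonneg_of_inner_eq_ofReal (fun v => ?_) (inner_opMat_combMat V)
  positivity

variable [Fintype A] [DecidableEq β] {L : A → Matrix (α × β) β (K →L[ℂ] K)}

namespace IsComb

theorem map {K' : Type*} [NormedAddCommGroup K'] [InnerProductSpace ℂ K'] [CompleteSpace K']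
    (hL : IsComb L) (φ : (K →L[ℂ] K) →⋆ₐ[ℂ] (K' →L[ℂ] K')) : IsComb fun a => (L a).map φ := by
  have h := congrArg (RingHom.mapMatrix (φ : (K →L[ℂ] K) →+* (K' →L[ℂ] K'))) hL
  rw [map_one, map_sum] at h
  simp only [IsComb, ← h]
  refine Finset.sum_congr rfl fun a _ => ?_
  ext1 i j
  simp only [Matrix.mul_apply, Matrix.conjTranspose_apply, Matrix.map_apply,
    RingHom.mapMatrix_apply, map_sum, map_mul, RingHom.coe_coe, map_star]

theorem sum_norm_sq (hL : IsComb L) (w : β → K) :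
    ∑ a, ∑ r, ‖∑ h, L a r h (w h)‖ ^ 2 = ∑ h, ‖w h‖ ^ 2 := by
  apply Complex.ofReal_injective
  rw [Complex.ofReal_sum]
  simp only [ofReal_sum_norm_sq_eq_sum_inner]
  calc ∑ a, ∑ h', ∑ h, inner ℂ (w h') (((L a).conjTranspose * L a) h' h (w h))
      = ∑ h', ∑ h, inner ℂ (w h') ((∑ a, (L a).conjTranspose * L a) h' h (w h)) := by
        simp only [Matrix.sum_apply, sum_apply, inner_sum]
        rw [Finset.sum_comm]
        exact Finset.sum_congr rfl fun h' _ => Finset.sum_comm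
    _ = ∑ h', inner ℂ (w h') (w h') := by
        rw [hL]
        refine Finset.sum_congr rfl fun h' _ => ?_
        rw [Finset.sum_eq_single h'] <;> simp +contextual [eq_comm]
    _ = _ := by simp [inner_self_eq_norm_sq_to_K]

theorem sum_opMat_combMat_le_one [DecidableEq α] [Nonempty α] (hL : IsComb L) :
    ∑ a, opMat (α × β) K (combMat (L a)) ≤ 1 := by
  rw [← sub_nonneg]
  refine nonneg_of_inner_eq_ofReal (Q := fun v => ‖v‖ ^ 2 - ∑ a, (Fintype.card α : ℝ)⁻¹ *
    ∑ g, ‖∑ r : α × β, L a (r.1, g) r.2 (v r)‖ ^ 2) (fun v => ?_) fun v => ?_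
  · rw [sub_nonneg, ← Finset.mul_sum, inv_mul_le_iff₀ (by exact_mod_cast Fintype.card_pos)]
    calc ∑ a, ∑ g, ‖∑ r : α × β, L a (r.1, g) r.2 (v r)‖ ^ 2
        = ∑ a, ∑ g, ‖∑ k, ∑ h, L a (k, g) h (v (k, h))‖ ^ 2 := by
          simp only [Fintype.sum_prod_type]
      _ ≤ ∑ a, ∑ g, Fintype.card α * ∑ k, ‖∑ h, L a (k, g) h (v (k, h))‖ ^ 2 := by
          gcongr
          exact norm_sum_sq_le_card_mul_sum_norm_sq _
      _ ≤ ∑ a, ∑ g, Fintype.card α * ∑ k, ∑ k', ‖∑ h, L a (k', g) h (v (k, h))‖ ^ 2 := by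
          gcongr with a _ g _ k
          exact Finset.single_le_sum (f := fun k' => ‖∑ h, L a (k', g) h (v (k, h))‖ ^ 2)
            (fun k' _ => by positivity) (Finset.mem_univ k)
      _ = Fintype.card α * ∑ k, ∑ a, ∑ r, ‖∑ h, L a r h (v (k, h))‖ ^ 2 := by
          simp only [← Finset.mul_sum, Fintype.sum_prod_type]
          rw [Finset.sum_comm (s := Finset.univ (α := α))]
          congr 1
          refine Finset.sum_congr rfl fun a _ => ?_
          rw [Finset.sum_comm]
          exact Finset.sum_congr rfl fun k _ => Finset.sum_comm
      _ = Fintype.card α * ‖v‖ ^ 2 := by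
          rw [PiLp.norm_sq_eq_of_L2, Fintype.sum_prod_type]
          simp only [hL.sum_norm_sq fun h => v (_, h)]
  · rw [sub_apply, inner_sub_right, sum_apply, inner_sum]
    simp only [inner_opMat_combMat]
    push_cast
    congr 1
    exact inner_self_eq_norm_sq_to_K (𝕜 := ℂ) v

theorem sum_combMat_diag (hL : IsComb L) :
    ∑ a, ∑ r, combMat (L a) r r = ((Fintype.card α : ℂ)⁻¹ * Fintype.card β) • 1 := by
  calc ∑ a, ∑ r, combMat (L a) r r
      = (Fintype.card α : ℂ)⁻¹ • ∑ a, ∑ r : α × β, ∑ g,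
          star (L a (r.1, g) r.2) * L a (r.1, g) r.2 := by
        simp only [Finset.smul_sum, combMat, Matrix.smul_apply, Matrix.mul_apply]
        rfl
    _ = (Fintype.card α : ℂ)⁻¹ • ∑ h, (∑ a, (L a).conjTranspose * L a) h h := by
        simp only [Matrix.sum_apply, Matrix.mul_apply, Matrix.conjTranspose_apply,
          Fintype.sum_prod_type]
        congr 1
        rw [Finset.sum_comm (s := Finset.univ (α := β))]
        exact Finset.sum_congr rfl fun a _ => Finset.sum_comm
    _ = _ := by
        have hL1 : ∑ a, (L a).conjTranspose * L a = 1 := hL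
        simp [hL1, mul_smul, Nat.cast_smul_eq_nsmul]

end IsComb

end Comb

/-! ### Postselected teleportation -/

section MaxEntangled

variable {σ τ H : Type*} [Fintype σ] [Fintype τ] [DecidableEq σ]
  [NormedAddCommGroup H] [InnerProductSpace ℂ H]

/-- The maximally entangled state of two registers that are identified by `e`, tensored
with `ψ`. -/
def maxEntangled (e : τ ≃ σ) (ψ : H) : DirectSumSpace τ (DirectSumSpace σ H) :=
  ((√(Fintype.card τ))⁻¹ : ℂ) • WithLp.toLp 2 fun s => PiLp.single 2 (e s) ψ

theorem norm_maxEntangled [Nonempty τ] (e : τ ≃ σ) (ψ : H) : ‖maxEntangled e ψ‖ = ‖ψ‖ := by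
  have hsqrt : √(Fintype.card τ : ℝ) ≠ 0 := by positivity
  rw [maxEntangled, norm_smul, PiLp.norm_eq_of_L2]
  simp [abs_of_nonneg (Real.sqrt_nonneg _), hsqrt]

variable [DecidableEq τ] [CompleteSpace H]

theorem inner_maxEntangled (e : τ ≃ σ) (ψ : H) (M : Matrix σ σ (H →L[ℂ] H))
    (N : Matrix τ τ (H →L[ℂ] H)) :
    inner ℂ (maxEntangled e ψ) ((ampliation τ (DirectSumSpace σ H) (opMat σ H M) *
      opMat τ (DirectSumSpace σ H) (N.map (ampliation σ H))) (maxEntangled e ψ)) =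
      (Fintype.card τ : ℂ)⁻¹ * ∑ s', ∑ s, inner ℂ ψ ((M (e s') (e s) * N s' s) ψ) := by
  have hsqrt : ((√(Fintype.card τ : ℝ) : ℂ))⁻¹ * ((√(Fintype.card τ : ℝ) : ℂ))⁻¹ =
      (Fintype.card τ : ℂ)⁻¹ := by
    rw [← mul_inv, ← Complex.ofReal_mul, Real.mul_self_sqrt (Nat.cast_nonneg _),
      Complex.ofReal_natCast]
  rw [maxEntangled, map_smul, inner_smul_left, inner_smul_right, ← mul_assoc, map_inv₀,
    Complex.conj_ofReal, hsqrt, PiLp.inner_apply]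
  congr 1
  refine Finset.sum_congr rfl fun s' _ => ?_
  simp only [mul_apply_eq_comp, ampliation_apply, opMat_apply (n := τ), map_sum, inner_sum,
    inner_single_left, Matrix.map_apply, ampliation_single, opMat_single]

theorem inner_maxEntangled_ampliation (e : τ ≃ σ) (ψ : H) (M : Matrix σ σ (H →L[ℂ] H)) :
    inner ℂ (maxEntangled e ψ)
      (ampliation τ (DirectSumSpace σ H) (opMat σ H M) (maxEntangled e ψ)) =
      (Fintype.card τ : ℂ)⁻¹ * ∑ s, inner ℂ ψ (M s s ψ) := by
  have h := inner_maxEntangled e ψ M 1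
  rw [Matrix.map_one _ (map_zero _) (map_one _), map_one, mul_one] at h
  rw [h, ← Equiv.sum_comp e]
  congr 1
  refine Finset.sum_congr rfl fun s' _ => ?_
  rw [Finset.sum_eq_single s'] <;> simp +contextual [eq_comm]

theorem inner_maxEntangled_opMat (e : τ ≃ σ) (ψ : H) (N : Matrix τ τ (H →L[ℂ] H)) :
    inner ℂ (maxEntangled e ψ)
      (opMat τ (DirectSumSpace σ H) (N.map (ampliation σ H)) (maxEntangled e ψ)) =
      (Fintype.card τ : ℂ)⁻¹ * ∑ s, inner ℂ ψ (N s s ψ) := by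
  have h := inner_maxEntangled e ψ 1 N
  rw [map_one, map_one, one_mul] at h
  rw [h]
  congr 1
  refine Finset.sum_congr rfl fun s' _ => ?_
  rw [Finset.sum_eq_single s'] <;> simp +contextual [eq_comm]

end MaxEntangled

section Teleportation

variable {α β H : Type*} [Fintype α] [Fintype β] [NormedAddCommGroup H] [InnerProductSpace ℂ H]
  [CompleteSpace H] {𝒜 ℬ : StarSubalgebra ℂ (H →L[ℂ] H)}

theorem sum_inner_combMat_mul (h𝒜ℬ : ∀ S ∈ 𝒜, ∀ T ∈ ℬ, Commute S T)
    {V : Matrix (α × β) β (H →L[ℂ] H)} (hV : ∀ r h, V r h ∈ 𝒜)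
    {W : Matrix (β × α) α (H →L[ℂ] H)} (hW : ∀ r h, W r h ∈ ℬ) (ψ : H) :
    ∑ s' : β × α, ∑ s : β × α, inner ℂ ψ ((combMat V s'.swap s.swap * combMat W s' s) ψ) =
      ((Fintype.card α : ℂ) * Fintype.card β)⁻¹ *
        ((∑ t : β × α, ‖∑ s : β × α, (V (s.2, t.1) s.1 * W (s.1, t.2) s.2) ψ‖ ^ 2 : ℝ) : ℂ) := by
  let Z : Matrix (β × α) (β × α) (H →L[ℂ] H) :=
    Matrix.of fun t s => V (s.2, t.1) s.1 * W (s.1, t.2) s.2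
  have hZ : ∀ s' s, combMat V s'.swap s.swap * combMat W s' s =
      ((Fintype.card α : ℂ) * Fintype.card β)⁻¹ • (Z.conjTranspose * Z) s' s := fun s' s => by
    have hterm : ∀ v' ∈ 𝒜, ∀ v ∈ 𝒜, ∀ w' ∈ ℬ, ∀ w,
        star v' * v * (star w' * w) = star (v' * w') * (v * w) := fun v' hv' v hv w' hw' w => by
      rw [star_mul, mul_assoc, ← mul_assoc v, (h𝒜ℬ v hv _ (star_mem hw')).eq,
        ← (h𝒜ℬ _ (star_mem hv') _ (star_mem hw')).eq]
      simp only [mul_assoc]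
    simp only [combMat, Matrix.smul_apply, smul_mul_smul_comm, ← mul_inv, Matrix.mul_apply,
      Finset.sum_mul_sum, Fintype.sum_prod_type]
    congr 1
    exact Finset.sum_congr rfl fun g _ => Finset.sum_congr rfl fun f _ =>
      hterm _ (hV _ _) _ (hV _ _) _ (hW _ _) _
  have hnorm := ofReal_sum_norm_sq_eq_sum_inner Z fun _ => ψ
  simp only [hZ, smul_apply, inner_smul_right, ← Finset.mul_sum, ← hnorm]
  rfl

variable [DecidableEq α] [DecidableEq β]

/-- The generalized measurement operator of the player who is teleported the register `β` and
teleports the register `α`, on his halves of the two maximally entangled states. -/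
def teleportLeft (V : Matrix (α × β) β (H →L[ℂ] H)) :
    DirectSumSpace (β × α) (DirectSumSpace (α × β) H) →L[ℂ]
      DirectSumSpace (β × α) (DirectSumSpace (α × β) H) :=
  ampliation (β × α) (DirectSumSpace (α × β) H) (opMat (α × β) H (combMat V))

/-- The counterpart of `teleportLeft` for the other player. -/
def teleportRight (W : Matrix (β × α) α (H →L[ℂ] H)) :
    DirectSumSpace (β × α) (DirectSumSpace (α × β) H) →L[ℂ]
      DirectSumSpace (β × α) (DirectSumSpace (α × β) H) :=
  opMat (β × α) (DirectSumSpace (α × β) H) ((combMat W).map (ampliation (α × β) H))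

theorem commute_teleport (h𝒜ℬ : ∀ S ∈ 𝒜, ∀ T ∈ ℬ, Commute S T)
    {V : Matrix (α × β) β (H →L[ℂ] H)} (hV : ∀ r h, V r h ∈ 𝒜)
    {W : Matrix (β × α) α (H →L[ℂ] H)} (hW : ∀ r h, W r h ∈ ℬ) :
    Commute (teleportLeft V) (teleportRight W) :=
  commute_ampliation_opMat fun i j => (commute_ampliation_opMat fun r' r =>
    (h𝒜ℬ _ (combMat_mem hV r' r) _ (combMat_mem hW i j)).symm).symm

theorem teleportLeft_nonneg (V : Matrix (α × β) β (H →L[ℂ] H)) : 0 ≤ teleportLeft V :=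
  map_nonneg _ (opMat_combMat_nonneg V)

theorem teleportRight_nonneg (W : Matrix (β × α) α (H →L[ℂ] H)) : 0 ≤ teleportRight W := by
  rw [teleportRight, ← combMat_map]
  exact opMat_combMat_nonneg _

theorem inner_teleport (h𝒜ℬ : ∀ S ∈ 𝒜, ∀ T ∈ ℬ, Commute S T)
    {V : Matrix (α × β) β (H →L[ℂ] H)} (hV : ∀ r h, V r h ∈ 𝒜)
    {W : Matrix (β × α) α (H →L[ℂ] H)} (hW : ∀ r h, W r h ∈ ℬ) (ψ : H) :
    inner ℂ (maxEntangled (Equiv.prodComm β α) ψ) ((teleportLeft V * teleportRight W)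
      (maxEntangled (Equiv.prodComm β α) ψ)) =
      (((((Fintype.card α : ℝ) * Fintype.card β) ^ 2)⁻¹ *
        ∑ t : β × α, ‖∑ s : β × α, (V (s.2, t.1) s.1 * W (s.1, t.2) s.2) ψ‖ ^ 2 : ℝ) : ℂ) := by
  refine (inner_maxEntangled _ _ _ _).trans ?_
  refine (congrArg _ (sum_inner_combMat_mul h𝒜ℬ hV hW ψ)).trans ?_
  rw [Fintype.card_prod, ← mul_assoc, ← mul_inv]
  push_cast
  ring

section Sum

variable {A : Type*} [Fintype A]

theorem sum_teleportLeft_le_one [Nonempty α] {L : A → Matrix (α × β) β (H →L[ℂ] H)}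
    (hL : IsComb L) : ∑ a, teleportLeft (L a) ≤ 1 := by
  simp only [teleportLeft]
  rw [← map_sum, ← map_one (ampliation (β × α) (DirectSumSpace (α × β) H))]
  exact OrderHomClass.mono _ hL.sum_opMat_combMat_le_one

theorem sum_teleportRight_le_one [Nonempty β] {R : A → Matrix (β × α) α (H →L[ℂ] H)}
    (hR : IsComb R) : ∑ a, teleportRight (R a) ≤ 1 := by
  simp only [teleportRight, ← combMat_map]
  exact (hR.map _).sum_opMat_combMat_le_one

theorem sum_inner_teleportLeft [Nonempty α] [Nonempty β]
    {L : A → Matrix (α × β) β (H →L[ℂ] H)} (hL : IsComb L) {ψ : H} (hψ : ‖ψ‖ = 1) :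
    inner ℂ (maxEntangled (Equiv.prodComm β α) ψ)
      ((∑ a, teleportLeft (L a)) (maxEntangled (Equiv.prodComm β α) ψ)) =
      (((Fintype.card α : ℝ) ^ 2)⁻¹ : ℝ) := by
  simp only [sum_apply, inner_sum, teleportLeft, inner_maxEntangled_ampliation]
  rw [← Finset.mul_sum]
  simp only [← inner_sum, ← sum_apply]
  rw [hL.sum_combMat_diag, smul_apply, inner_smul_right, one_apply_eq_self,
    inner_self_eq_norm_sq_to_K, hψ, Fintype.card_prod]
  have hα : (Fintype.card α : ℂ) ≠ 0 := Nat.cast_ne_zero.2 Fintype.card_ne_zero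
  have hβ : (Fintype.card β : ℂ) ≠ 0 := Nat.cast_ne_zero.2 Fintype.card_ne_zero
  push_cast
  field_simp

theorem sum_inner_teleportRight [Nonempty α] [Nonempty β]
    {R : A → Matrix (β × α) α (H →L[ℂ] H)} (hR : IsComb R) {ψ : H} (hψ : ‖ψ‖ = 1) :
    inner ℂ (maxEntangled (Equiv.prodComm β α) ψ)
      ((∑ a, teleportRight (R a)) (maxEntangled (Equiv.prodComm β α) ψ)) =
      (((Fintype.card β : ℝ) ^ 2)⁻¹ : ℝ) := by
  simp only [sum_apply, inner_sum, teleportRight, inner_maxEntangled_opMat]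
  rw [← Finset.mul_sum]
  simp only [← inner_sum, ← sum_apply]
  rw [hR.sum_combMat_diag, smul_apply, inner_smul_right, one_apply_eq_self,
    inner_self_eq_norm_sq_to_K, hψ, Fintype.card_prod]
  have hα : (Fintype.card α : ℂ) ≠ 0 := Nat.cast_ne_zero.2 Fintype.card_ne_zero
  have hβ : (Fintype.card β : ℂ) ≠ 0 := Nat.cast_ne_zero.2 Fintype.card_ne_zero
  push_cast
  field_simp

end Sum

end Teleportation

/-- Teleportation succeeds without corrections with probability `(|α| |β|)⁻²`; all other runs are
collected in the outcome `none`. -/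
theorem exists_mem_quantumSet_of_isComb {X Y A B : Type*} {α β H : Type}
    [Fintype A] [Fintype B] [Fintype α] [Fintype β] [DecidableEq α] [DecidableEq β] [Nonempty α]
    [Nonempty β] [NormedAddCommGroup H] [InnerProductSpace ℂ H] [CompleteSpace H]
    {𝒜 ℬ : StarSubalgebra ℂ (H →L[ℂ] H)}
    (h𝒜ℬ : ∀ S ∈ 𝒜, ∀ T ∈ ℬ, Commute S T) {L : X → A → Matrix (α × β) β (H →L[ℂ] H)}
    (hL : ∀ x, IsComb (L x)) (hLmem : ∀ x a r h, L x a r h ∈ 𝒜)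
    {R : Y → B → Matrix (β × α) α (H →L[ℂ] H)} (hR : ∀ y, IsComb (R y))
    (hRmem : ∀ y b r h, R y b r h ∈ ℬ) {ψ : H} (hψ : ‖ψ‖ = 1) :
    ∃ T ∈ quantumSet X Y (Option A) (Option B),
      (∀ x y a b, T x y (some a) (some b) = (((Fintype.card α : ℝ) * Fintype.card β) ^ 2)⁻¹ *
        ∑ t : β × α, ‖∑ s : β × α, (L x a (s.2, t.1) s.1 * R y b (s.1, t.2) s.2) ψ‖ ^ 2) ∧
      (∀ x y, ∑ a, ∑ b, T x y (some a) b = ((Fintype.card α : ℝ) ^ 2)⁻¹) ∧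
      ∀ x y, ∑ b, ∑ a, T x y a (some b) = ((Fintype.card β : ℝ) ^ 2)⁻¹ := by
  let Ψ := maxEntangled (Equiv.prodComm β α) ψ
  let E := fun x => completeMeas fun a => teleportLeft (L x a)
  let F := fun y => completeMeas fun b => teleportRight (R y b)
  have hΨ : ‖Ψ‖ = 1 := (norm_maxEntangled _ ψ).trans hψ
  have hE : ∀ x, IsPOVM (E x) := fun x =>
    isPOVM_completeMeas (fun _ => teleportLeft_nonneg _) (sum_teleportLeft_le_one (hL x))
  have hF : ∀ y, IsPOVM (F y) := fun y =>
    isPOVM_completeMeas (fun _ => teleportRight_nonneg _) (sum_teleportRight_le_one (hR y))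
  have hEF : ∀ x y a b, Commute (E x a) (F y b) := fun x y a b =>
    commute_completeMeas (fun a => (commute_completeMeas (fun b =>
      (commute_teleport h𝒜ℬ (hLmem x a) (hRmem y b)).symm) b).symm) a
  refine ⟨expectationTable Ψ E F, expectationTable_mem_quantumSet hΨ hE hF hEF,
    fun x y a b => ?_, fun x y => ?_, fun x y => ?_⟩
  · exact congrArg Complex.re (inner_teleport h𝒜ℬ (hLmem x a) (hRmem y b) ψ)
  · simp only [sum_expectationTable_right, (hF y).sum_eq_one, mul_one, ← Complex.re_sum,
      ← inner_sum, ← sum_apply]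
    exact congrArg Complex.re (sum_inner_teleportLeft (hL x) hψ)
  · simp only [sum_expectationTable_left, (hE x).sum_eq_one, one_mul, ← Complex.re_sum,
      ← inner_sum, ← sum_apply]
    exact congrArg Complex.re (sum_inner_teleportRight (hR y) hψ)

/-! ### Entanglement-assisted protocols as combs -/

namespace QProtocol

variable {X Y A B : Type*} [Fintype A] [Fintype B] {q : ℕ} {H : Type*}
  [NormedAddCommGroup H] [InnerProductSpace ℂ H] [CompleteSpace H] (π : QProtocol X Y A B q H)

/-- The computational basis of the qubits sent by Alice. -/
abbrev QubitsA : Type := {i // π.fromAlice i = true} → Bool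

/-- The computational basis of the qubits sent by Bob. -/
abbrev QubitsB : Type := {i // ¬ π.fromAlice i = true} → Bool

/-- The splitting of the computational basis of all qubits by their senders. -/
def joinQubits : π.QubitsA × π.QubitsB ≃ (Fin q → Bool) :=
  (Equiv.piEquivPiSubtypeProd (fun i => π.fromAlice i = true) fun _ => Bool).symm

theorem merge_joinQubits (r s : π.QubitsA × π.QubitsB) :
    merge π.fromAlice (π.joinQubits r) (π.joinQubits s) = π.joinQubits (r.1, s.2) := by
  ext i
  simp only [merge, joinQubits, Equiv.piEquivPiSubtypeProd_symm_apply]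
  split_ifs <;> rfl

theorem joinQubits_const_false :
    π.joinQubits (fun _ => false, fun _ => false) = fun _ => false := by
  ext i
  simp [joinQubits, Equiv.piEquivPiSubtypeProd_symm_apply]

theorem card_qubitsA_mul_card_qubitsB :
    Fintype.card π.QubitsA * Fintype.card π.QubitsB = 2 ^ q := by
  rw [← Fintype.card_prod, Fintype.card_congr π.joinQubits]
  simp

/-- Alice's part of the protocol: she receives Bob's qubits, and her own start in `|0⟩`. -/
def combA (x : X) (a : A) : Matrix (π.QubitsA × π.QubitsB) π.QubitsB (H →L[ℂ] H) :=
  (π.finalA x a).submatrix π.joinQubits fun h => π.joinQubits (fun _ => false, h)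

/-- Bob's part of the protocol: he receives Alice's qubits, and his own start in `|0⟩`. -/
def combB (y : Y) (b : B) : Matrix (π.QubitsB × π.QubitsA) π.QubitsA (H →L[ℂ] H) :=
  (π.finalB y b).submatrix ((Equiv.prodComm _ _).trans π.joinQubits)
    fun k => π.joinQubits (k, fun _ => false)

theorem isComb_combA (x : X) : IsComb (π.combA x) :=
  isComb_submatrix_of_isProjMeas (π.measA_proj x) (π.partA_mem_unitary x _) π.joinQubits
    fun _ _ h => congrArg Prod.snd (π.joinQubits.injective h)

theorem isComb_combB (y : Y) : IsComb (π.combB y) :=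
  isComb_submatrix_of_isProjMeas (π.measB_proj y) (π.partB_mem_unitary y _)
    ((Equiv.prodComm _ _).trans π.joinQubits)
    fun _ _ h => congrArg Prod.fst (π.joinQubits.injective h)

theorem link_joinQubits (x : X) (y : Y) (a : A) (b : B) (t : π.QubitsB × π.QubitsA) :
    link π.fromAlice (π.finalA x a) (π.finalB y b) (π.joinQubits t.swap) =
      ∑ s : π.QubitsB × π.QubitsA, π.combA x a (s.2, t.1) s.1 * π.combB y b (s.1, t.2) s.2 := by
  rw [link, ← Equiv.sum_comp ((Equiv.prodComm _ _).trans π.joinQubits)]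
  refine Finset.sum_congr rfl fun s _ => ?_
  rw [← π.joinQubits_const_false]
  simp only [Equiv.trans_apply, Equiv.prodComm_apply, merge_joinQubits]
  rfl

theorem prob_eq_sum_comb (x : X) (y : Y) (a : A) (b : B) : π.prob x y a b =
    ((∑ t : π.QubitsB × π.QubitsA, ‖∑ s : π.QubitsB × π.QubitsA,
      (π.combA x a (s.2, t.1) s.1 * π.combB y b (s.1, t.2) s.2) π.ψ‖ ^ 2 : ℝ) : ℂ) := by
  rw [prob_eq_sum, ← Equiv.sum_comp ((Equiv.prodComm _ _).trans π.joinQubits)]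
  simp only [Equiv.trans_apply, Equiv.prodComm_apply, link_joinQubits, sum_apply]

end QProtocol

/-- Because of the last two clauses, correlations lose a factor of only `d * d' = 2 ^ q`. -/
theorem QuantumSim.exists_postselection {X Y A B : Type*} [Fintype A] [Fintype B] {q : ℕ}
    {p : Table X Y A B} (hp : QuantumSim q p) :
    ∃ T ∈ quantumSet X Y (Option A) (Option B), ∃ d d' : ℝ, 0 < d ∧ 0 < d' ∧ d * d' = 2 ^ q ∧
      (∀ x y a b, 4 ^ q * T x y (some a) (some b) = p x y a b) ∧
      (∀ x y, ∑ a, ∑ b, T x y (some a) b = (d ^ 2)⁻¹) ∧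
      ∀ x y, ∑ b, ∑ a, T x y a (some b) = (d' ^ 2)⁻¹ := by
  obtain ⟨H, _, _, _, π, hπ⟩ := hp
  obtain ⟨T, hT, hTp, hTA, hTB⟩ := exists_mem_quantumSet_of_isComb π.commute π.isComb_combA
    (fun x a _ _ => (π.actsOn_univ_finalA x a).mem _ _) π.isComb_combB
    (fun y b _ _ => (π.actsOn_univ_finalB y b).mem _ _) π.norm_ψ
  have hcard : (Fintype.card π.QubitsA : ℝ) * Fintype.card π.QubitsB = 2 ^ q := by
    exact_mod_cast π.card_qubitsA_mul_card_qubitsB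
  refine ⟨T, hT, Fintype.card π.QubitsA, Fintype.card π.QubitsB, by positivity, by positivity,
    hcard, fun x y a b => ?_, hTA, hTB⟩
  have h4 : (4 : ℝ) ^ q = (2 ^ q) ^ 2 := by rw [← pow_mul, mul_comm, pow_mul]; norm_num
  rw [hTp, hcard, h4, mul_inv_cancel_left₀ (by positivity)]
  exact Complex.ofReal_injective ((π.prob_eq_sum_comb x y a b).symm.trans (hπ x y a b).symm)

theorem gammaTilde_le_of_quantumSim {X Y A B : Type*} [Finite X] [Nonempty X] [Nonempty Y]
    [Fintype A] [Fintype B] {q : ℕ} {p : Table X Y A B} (hp : NonSignaling p)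
    (hsim : QuantumSim q p) : gammaTilde p ≤ 2 * 4 ^ q - 1 := by
  obtain ⟨x⟩ := ‹Nonempty X›
  obtain ⟨y⟩ := ‹Nonempty Y›
  have hsum : ∑ a, ∑ b, p x y a b ≠ 0 := by rw [hp.sum_eq_one]; exact one_ne_zero
  obtain ⟨a, -, ha⟩ := Finset.exists_ne_zero_of_sum_ne_zero hsum
  obtain ⟨b, -, -⟩ := Finset.exists_ne_zero_of_sum_ne_zero ha
  have : Nonempty A := ⟨a⟩
  have : Nonempty B := ⟨b⟩
  obtain ⟨T, hT, -, -, -, -, -, hTp, -, -⟩ := hsim.exists_postselection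
  exact affineCost_le_of_postselection hp (nonSignaling_of_mem_quantumSet hT) (by positivity) hTp
    fun κ η hκ hη => postprocess_mem_quantumSet hκ hη hT

/-! ### Tsirelson's theorem -/

section Involutions

theorem sum_intUnits {M : Type*} [AddCommMonoid M] (f : ℤˣ → M) : ∑ a, f a = f 1 + f (-1) :=
  Finset.sum_pair (by decide)

theorem isProjMeas_of_involution {R : Type*} [Ring R] [StarRing R] [Algebra ℂ R] [StarModule ℂ R]
    {T : R} (hT : star T = T) (hT2 : T * T = 1) :
    IsProjMeas fun a : ℤˣ => (1 / 2 : ℂ) • (1 + ((a : ℤ) : ℂ) • T) where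
  selfAdjoint a := by simp [hT]
  mul_eq a a' := by
    have hmul : ((1 / 2 : ℂ) • (1 + ((a : ℤ) : ℂ) • T)) * ((1 / 2 : ℂ) • (1 + ((a' : ℤ) : ℂ) • T)) =
        ((1 + ((a : ℤ) : ℂ) * ((a' : ℤ) : ℂ)) / 4) • (1 : R) +
          ((((a : ℤ) : ℂ) + ((a' : ℤ) : ℂ)) / 4) • T := by
      simp only [smul_mul_smul_comm, add_mul, mul_add, one_mul, mul_one, hT2]
      module
    rw [hmul]
    rcases Int.units_eq_one_or a with rfl | rfl <;> rcases Int.units_eq_one_or a' with rfl | rfl <;>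
      simp <;> module
  sum_eq_one := by
    simp only [sum_intUnits, Units.val_one, Units.val_neg, Int.cast_one, Int.cast_neg]
    module

theorem uniformMarginals_mem_quantumSet_of_involutions {X Y : Type*} {H : Type}
    [NormedAddCommGroup H] [InnerProductSpace ℂ H] [CompleteSpace H] {ψ : H} (hψ : ‖ψ‖ = 1)
    {S : X → H →L[ℂ] H} {T : Y → H →L[ℂ] H} (hS : ∀ x, star (S x) = S x)
    (hS2 : ∀ x, S x * S x = 1) (hT : ∀ y, star (T y) = T y) (hT2 : ∀ y, T y * T y = 1)
    (hcomm : ∀ x y, Commute (S x) (T y)) (hS0 : ∀ x, inner ℂ ψ (S x ψ) = 0)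
    (hT0 : ∀ y, inner ℂ ψ (T y ψ) = 0) {C : X → Y → ℝ}
    (hST : ∀ x y, inner ℂ ψ ((S x * T y) ψ) = C x y) :
    uniformMarginals C ∈ quantumSet X Y ℤˣ ℤˣ := by
  refine ⟨H, inferInstance, inferInstance, inferInstance, ψ,
    fun x a => (1 / 2 : ℂ) • (1 + ((a : ℤ) : ℂ) • S x),
    fun y b => (1 / 2 : ℂ) • (1 + ((b : ℤ) : ℂ) • T y), hψ,
    fun x => isProjMeas_of_involution (hS x) (hS2 x),
    fun y => isProjMeas_of_involution (hT y) (hT2 y), fun x y a b => ?_, fun x y a b => ?_⟩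
  · have hadd : Commute (1 + ((a : ℤ) : ℂ) • S x) (1 + ((b : ℤ) : ℂ) • T y) :=
      (Commute.one_left _).add_left ((Commute.one_right _).add_right
        (((hcomm x y).smul_left _).smul_right _))
    exact (hadd.smul_left _).smul_right _
  · have hmul :
        ((1 / 2 : ℂ) • (1 + ((a : ℤ) : ℂ) • S x)) * ((1 / 2 : ℂ) • (1 + ((b : ℤ) : ℂ) • T y)) =
        (1 / 4 : ℂ) • (1 + ((a : ℤ) : ℂ) • S x + ((b : ℤ) : ℂ) • T y +
          (((a : ℤ) : ℂ) * ((b : ℤ) : ℂ)) • (S x * T y)) := by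
      simp only [smul_mul_smul_comm, add_mul, mul_add, one_mul, mul_one]
      module
    rw [hmul]
    simp only [smul_apply, add_apply, inner_smul_right, inner_add_right, one_apply_eq_self, hS0,
      hT0, hST, inner_self_eq_norm_sq_to_K, hψ, uniformMarginals]
    push_cast
    ring

end Involutions

section Clifford

/-- Self-adjoint involutions that pairwise anticommute: a representation of the generators of a
Clifford algebra. -/
structure IsCliffordFamily {ι R : Type*} [DecidableEq ι] [Ring R] [StarRing R] (γ : ι → R) :
    Prop where
  star_eq : ∀ i, star (γ i) = γ i
  mul_add_mul : ∀ i j, γ i * γ j + γ j * γ i = if i = j then 2 else 0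

/-- One more generator: `σ_z ⊗ 1`, preceding the `σ_x ⊗ γ i`. -/
def cliffordExtend {d R : Type*} [DecidableEq d] [Ring R] {n : ℕ} (γ : Fin n → Matrix d d R) :
    Fin (n + 1) → Matrix (d ⊕ d) (d ⊕ d) R :=
  Fin.cons (Matrix.fromBlocks 1 0 0 (-1)) fun i => Matrix.fromBlocks 0 (γ i) (γ i) 0

theorem isCliffordFamily_cliffordExtend {d R : Type*} [Fintype d] [DecidableEq d] [Ring R]
    [StarRing R] {n : ℕ} {γ : Fin n → Matrix d d R} (hγ : IsCliffordFamily γ) :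
    IsCliffordFamily (cliffordExtend γ) where
  star_eq := Fin.cases (by simp [cliffordExtend, Matrix.star_eq_conjTranspose,
    Matrix.fromBlocks_conjTranspose]) fun i => by
      have hi := hγ.star_eq i
      rw [Matrix.star_eq_conjTranspose] at hi
      simp [cliffordExtend, Matrix.star_eq_conjTranspose, Matrix.fromBlocks_conjTranspose, hi]
  mul_add_mul := by
    have two_eq : (2 : Matrix (d ⊕ d) (d ⊕ d) R) = Matrix.fromBlocks 2 0 0 2 := by
      rw [← one_add_one_eq_two, ← Matrix.fromBlocks_one, Matrix.fromBlocks_add, one_add_one_eq_two,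
        add_zero]
    refine Fin.cases (Fin.cases ?_ fun j => ?_) fun i => Fin.cases ?_ fun j => ?_
    · simp [cliffordExtend, Matrix.fromBlocks_multiply, two_eq,
        one_add_one_eq_two]
    · simp [cliffordExtend, Matrix.fromBlocks_multiply, Matrix.fromBlocks_add,
        (Fin.succ_ne_zero j).symm]
    · simp [cliffordExtend, Matrix.fromBlocks_multiply, Matrix.fromBlocks_add,
        Fin.succ_ne_zero]
    · simp only [cliffordExtend, Fin.cons_succ, Matrix.fromBlocks_multiply,
        Matrix.fromBlocks_add, zero_mul, mul_zero, zero_add, add_zero, hγ.mul_add_mul, Fin.succ_inj]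
      split_ifs
      exacts [two_eq.symm, Matrix.fromBlocks_zero]

theorem trace_cliffordExtend {d R : Type*} [Fintype d] [DecidableEq d] [Ring R] {n : ℕ}
    (γ : Fin n → Matrix d d R) : ∀ i, (cliffordExtend γ i).trace = 0 :=
  Fin.cases (by simp [cliffordExtend, Matrix.trace]) fun i => by
    simp [cliffordExtend, Matrix.trace]

theorem exists_isCliffordFamily (R : Type*) [Ring R] [StarRing R] (n : ℕ) :
    ∃ (d : Type) (_ : Fintype d) (_ : DecidableEq d) (_ : Nonempty d) (γ : Fin n → Matrix d d R),
      IsCliffordFamily γ ∧ ∀ i, (γ i).trace = 0 := by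
  induction n with
  | zero => exact ⟨Unit, inferInstance, inferInstance, inferInstance, fun i => i.elim0,
      ⟨fun i => i.elim0, fun i => i.elim0⟩, fun i => i.elim0⟩
  | succ n ih =>
    obtain ⟨d, _, _, _, γ, hγ, -⟩ := ih
    exact ⟨d ⊕ d, inferInstance, inferInstance, inferInstance, cliffordExtend γ,
      isCliffordFamily_cliffordExtend hγ, trace_cliffordExtend γ⟩

variable {ι R : Type*} [Fintype ι]

/-- Clifford multiplication by the vector `u`. -/
def cliffordMul [AddCommGroup R] [Module ℝ R] (γ : ι → R) (u : EuclideanSpace ℝ ι) : R :=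
  ∑ i, u i • γ i

namespace IsCliffordFamily

variable [DecidableEq ι] [Ring R] [StarRing R] [Algebra ℝ R] {γ : ι → R}

theorem star_cliffordMul [StarModule ℝ R] (hγ : IsCliffordFamily γ) (u : EuclideanSpace ℝ ι) :
    star (cliffordMul γ u) = cliffordMul γ u := by
  simp only [cliffordMul, star_sum, star_smul, hγ.star_eq, star_trivial]

theorem cliffordMul_mul_add_mul (hγ : IsCliffordFamily γ) (u v : EuclideanSpace ℝ ι) :
    cliffordMul γ u * cliffordMul γ v + cliffordMul γ v * cliffordMul γ u =
      (2 * inner ℝ u v) • (1 : R) := by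
  have hinner : inner ℝ u v = ∑ i, u i * v i := by simp [PiLp.inner_apply, mul_comm]
  calc cliffordMul γ u * cliffordMul γ v + cliffordMul γ v * cliffordMul γ u
      = ∑ i, ∑ j, (u i * v j) • (γ i * γ j + γ j * γ i) := by
        simp only [cliffordMul, Finset.sum_mul_sum, smul_mul_smul_comm, smul_add,
          Finset.sum_add_distrib]
        rw [Finset.sum_comm (f := fun i j => (v i * u j) • (γ i * γ j))]
        simp only [mul_comm (v _)]
    _ = ∑ i, (u i * v i) • (2 : R) := by
        simp only [hγ.mul_add_mul, smul_ite, smul_zero, Finset.sum_ite_eq, Finset.mem_univ, if_true]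
    _ = (2 * inner ℝ u v) • (1 : R) := by
        rw [hinner, ← Finset.sum_smul, ← one_add_one_eq_two (R := R), smul_add, ← two_smul ℝ,
          smul_smul]

theorem cliffordMul_mul_self (hγ : IsCliffordFamily γ) {u : EuclideanSpace ℝ ι} (hu : ‖u‖ = 1) :
    cliffordMul γ u * cliffordMul γ u = 1 := by
  have h := hγ.cliffordMul_mul_add_mul u u
  rw [real_inner_self_eq_norm_sq, hu, one_pow, ← two_smul ℝ, mul_smul, one_smul] at h
  exact smul_right_injective R (two_ne_zero (α := ℝ)) h

theorem trace_cliffordMul_mul {d : Type*} [Fintype d] [DecidableEq d] {γ : ι → Matrix d d ℂ}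
    (hγ : IsCliffordFamily γ) (u v : EuclideanSpace ℝ ι) :
    (cliffordMul γ u * cliffordMul γ v).trace = Fintype.card d * (inner ℝ u v : ℝ) := by
  have h := congrArg Matrix.trace (hγ.cliffordMul_mul_add_mul u v)
  rw [Matrix.trace_add, Matrix.trace_mul_comm (cliffordMul γ v), Matrix.trace_smul,
    Matrix.trace_one, Complex.real_smul] at h
  push_cast at h
  linear_combination h / 2

end IsCliffordFamily

theorem trace_cliffordMul {d : Type*} [Fintype d] {γ : ι → Matrix d d ℂ}
    (hγ : ∀ i, (γ i).trace = 0) (u : EuclideanSpace ℝ ι) : (cliffordMul γ u).trace = 0 := by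
  simp [cliffordMul, Matrix.trace_sum, Matrix.trace_smul, hγ]

end Clifford

section Tsirelson

variable {d : Type*} [Fintype d] [DecidableEq d]

/-- Complex matrices as matrices of scalars of the algebra `R`. -/
def scalarMat (R : Type*) [Ring R] [StarRing R] [Algebra ℂ R] [StarModule ℂ R] :
    Matrix d d ℂ →⋆ₐ[ℂ] Matrix d d R :=
  { (Algebra.ofId ℂ R).mapMatrix with
    map_star' := fun M => by
      ext i j
      exact algebraMap_star_comm (M j i) }

theorem scalarMat_apply (R : Type*) [Ring R] [StarRing R] [Algebra ℂ R] [StarModule ℂ R]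
    (M : Matrix d d ℂ) (i j : d) : scalarMat R M i j = algebraMap ℂ R (M i j) := rfl

variable {H : Type*} [NormedAddCommGroup H] [InnerProductSpace ℂ H] [CompleteSpace H]

theorem map_ampliation_scalarMat (M : Matrix d d ℂ) :
    (scalarMat (H →L[ℂ] H) M).map (ampliation d H) =
      scalarMat (DirectSumSpace d H →L[ℂ] DirectSumSpace d H) M := by
  ext1 i j
  exact AlgHomClass.commutes (ampliation d H) (M i j)

theorem inner_maxEntangled_scalarMat {ψ : H} (hψ : ‖ψ‖ = 1) (M N : Matrix d d ℂ) :
    inner ℂ (maxEntangled (Equiv.refl d) ψ)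
      ((ampliation d (DirectSumSpace d H) (opMat d H (scalarMat _ M)) *
        opMat d (DirectSumSpace d H) (scalarMat _ N)) (maxEntangled (Equiv.refl d) ψ)) =
      (Fintype.card d : ℂ)⁻¹ * (M * N.transpose).trace := by
  rw [← map_ampliation_scalarMat, inner_maxEntangled]
  simp [scalarMat_apply, Algebra.algebraMap_eq_smul_one, Matrix.trace, Matrix.mul_apply,
    inner_self_eq_norm_sq_to_K, hψ, mul_comm (N _ _)]

end Tsirelson

theorem uniformMarginals_mem_quantumSet_of_euclidean {X Y : Type*} {n : ℕ}
    {u : X → EuclideanSpace ℝ (Fin n)} {v : Y → EuclideanSpace ℝ (Fin n)}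
    (hu : ∀ x, ‖u x‖ = 1) (hv : ∀ y, ‖v y‖ = 1) :
    uniformMarginals (fun x y => inner ℝ (u x) (v y)) ∈ quantumSet X Y ℤˣ ℤˣ := by
  obtain ⟨d, _, _, _, γ, hγ, htr⟩ := exists_isCliffordFamily ℂ n
  have hcard : (Fintype.card d : ℂ) ≠ 0 := by simp
  let left := (ampliation d (DirectSumSpace d ℂ)).comp ((opMat d ℂ).comp (scalarMat _))
  let right := (opMat d (DirectSumSpace d ℂ)).comp (scalarMat _)
  let Ψ : DirectSumSpace d (DirectSumSpace d ℂ) := maxEntangled (Equiv.refl d) 1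
  have hinner : ∀ M N, inner ℂ Ψ ((left M * right N) Ψ) =
      (Fintype.card d : ℂ)⁻¹ * (M * N.transpose).trace :=
    inner_maxEntangled_scalarMat norm_one
  have hinner_left : ∀ M, inner ℂ Ψ (left M Ψ) = (Fintype.card d : ℂ)⁻¹ * M.trace := fun M => by
    simpa using hinner M 1
  have hinner_right : ∀ N, inner ℂ Ψ (right N Ψ) = (Fintype.card d : ℂ)⁻¹ * N.trace := fun N => by
    simpa using hinner 1 N
  have hstarT : ∀ y, star (cliffordMul γ (v y)).transpose = (cliffordMul γ (v y)).transpose :=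
    fun y => congrArg Matrix.transpose (hγ.star_cliffordMul (v y))
  refine uniformMarginals_mem_quantumSet_of_involutions (ψ := Ψ)
    (S := fun x => left (cliffordMul γ (u x)))
    (T := fun y => right (cliffordMul γ (v y)).transpose) ?_ (fun x => ?_) (fun x => ?_)
    (fun y => ?_) (fun y => ?_) (fun x y => ?_) (fun x => ?_) (fun y => ?_) (fun x y => ?_)
  · rw [norm_maxEntangled, norm_one]
  · rw [← map_star, hγ.star_cliffordMul]
  · rw [← map_mul, hγ.cliffordMul_mul_self (hu x), map_one]
  · rw [← map_star, hstarT]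
  · rw [← map_mul, ← Matrix.transpose_mul, hγ.cliffordMul_mul_self (hv y), Matrix.transpose_one,
      map_one]
  · exact commute_ampliation_opMat fun i j =>
      Algebra.commute_algebraMap_right ((cliffordMul γ (v y)).transpose i j) _
  · rw [hinner_left, trace_cliffordMul htr, mul_zero]
  · rw [hinner_right, Matrix.trace_transpose, trace_cliffordMul htr, mul_zero]
  · rw [hinner, Matrix.transpose_transpose, hγ.trace_cliffordMul_mul, inv_mul_cancel_left₀ hcard]

theorem uniformMarginals_inner_mem_quantumSet {X Y K : Type*} [Finite X] [Finite Y]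
    [NormedAddCommGroup K] [InnerProductSpace ℝ K] {u : X → K} {v : Y → K}
    (hu : ∀ x, ‖u x‖ = 1) (hv : ∀ y, ‖v y‖ = 1) :
    uniformMarginals (fun x y => inner ℝ (u x) (v y)) ∈ quantumSet X Y ℤˣ ℤˣ := by
  let V : Submodule ℝ K := Submodule.span ℝ (Set.range u ∪ Set.range v)
  have : FiniteDimensional ℝ V :=
    FiniteDimensional.span_of_finite ℝ ((Set.finite_range u).union (Set.finite_range v))
  let u' : X → V := fun x => ⟨u x, Submodule.subset_span (Or.inl ⟨x, rfl⟩)⟩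
  let v' : Y → V := fun y => ⟨v y, Submodule.subset_span (Or.inr ⟨y, rfl⟩)⟩
  let e := (stdOrthonormalBasis ℝ V).repr
  have h := uniformMarginals_mem_quantumSet_of_euclidean (u := fun x => e (u' x))
    (v := fun y => e (v' y)) (fun x => (e.norm_map _).trans (hu x))
    fun y => (e.norm_map _).trans (hv y)
  simp only [e.inner_map_map] at h
  exact h

/-! ### Correlations of quantum protocols -/

section Correlation

variable {X Y : Type*}

/-- The correlations `E[ab | x, y]` of a binary distribution. -/
def correlation (p : Table X Y ℤˣ ℤˣ) (x : X) (y : Y) : ℝ :=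
  ∑ a : ℤˣ, ∑ b : ℤˣ, ((a : ℤ) : ℝ) * ((b : ℤ) : ℝ) * p x y a b

section RealInner

variable {A B H : Type*} [NormedAddCommGroup H] [InnerProductSpace ℂ H] [CompleteSpace H]

theorem inner_mul_apply_of_star_eq {S : H →L[ℂ] H} (hS : star S = S) (T : H →L[ℂ] H) (ψ : H) :
    inner ℂ ψ ((S * T) ψ) = inner ℂ (S ψ) (T ψ) := by
  conv_lhs => rw [← hS]
  rw [mul_apply_eq_comp, ContinuousLinearMap.star_eq_adjoint,
    ContinuousLinearMap.adjoint_inner_right]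

theorem IsProjMeas.norm_sum_smul_sq [Fintype A] {E : A → H →L[ℂ] H} (hE : IsProjMeas E)
    (c : A → ℝ) (ψ : H) :
    ‖∑ a, c a • E a ψ‖ ^ 2 = ∑ a, c a ^ 2 * (inner ℂ ψ (E a ψ)).re := by
  classical
  let _ : InnerProductSpace ℝ H := InnerProductSpace.complexToReal
  have hinner : ∀ a a', inner ℝ (E a ψ) (E a' ψ) =
      if a = a' then (inner ℂ ψ (E a ψ)).re else 0 := fun a a' => by
    rw [real_inner_eq_re_inner ℂ, ← inner_mul_apply_of_star_eq (hE.selfAdjoint a), hE.mul_eq]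
    split_ifs <;> simp
  rw [← real_inner_self_eq_norm_sq]
  simp only [sum_inner, inner_sum, real_inner_smul_left, real_inner_smul_right, hinner, mul_ite,
    mul_zero, Finset.sum_ite_eq', Finset.mem_univ, if_true, sq, mul_assoc]

end RealInner

theorem QuantumSim.exists_unit_vectors [Nonempty X] [Nonempty Y] {q : ℕ} {p : Table X Y ℤˣ ℤˣ}
    (hp : QuantumSim q p) :
    ∃ (H : Type) (_ : NormedAddCommGroup H) (_ : InnerProductSpace ℝ H) (u : X → H) (v : Y → H),
      (∀ x, ‖u x‖ = 1) ∧ (∀ y, ‖v y‖ = 1) ∧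
      ∀ x y, correlation p x y = 2 ^ q * inner ℝ (u x) (v y) := by
  obtain ⟨T, hT, d, d', hd, hd', hdd, hTp, hTA, hTB⟩ := hp.exists_postselection
  obtain ⟨H, _, _, _, ψ, E, F, -, hE, hF, -, rfl⟩ := exists_expectationTable_of_mem_quantumSet hT
  let _ : InnerProductSpace ℝ H := InnerProductSpace.complexToReal
  let s : Option ℤˣ → ℝ := fun o => o.elim 0 fun a => ((a : ℤ) : ℝ)
  have hs_none : s none = 0 := rfl
  have hs_sq : ∀ a : ℤˣ, s (some a) ^ 2 = 1 := fun a => by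
    rcases Int.units_eq_one_or a with rfl | rfl <;> simp [s]
  have hnorm : ∀ {r : ℝ} {w : H}, 0 < r → ‖w‖ ^ 2 = (r ^ 2)⁻¹ → ‖r • w‖ = 1 := by
    intro r w hr hw
    rw [← inv_pow, sq_eq_sq₀ (norm_nonneg w) (by positivity)] at hw
    rw [norm_smul, hw, Real.norm_of_nonneg hr.le, mul_inv_cancel₀ hr.ne']
  refine ⟨H, inferInstance, inferInstance, fun x => d • ∑ o, s o • E x o ψ,
    fun y => d' • ∑ o, s o • F y o ψ, fun x => hnorm hd ?_, fun y => hnorm hd' ?_, fun x y => ?_⟩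
  · obtain ⟨y⟩ := ‹Nonempty Y›
    rw [(hE x).norm_sum_smul_sq, ← hTA x y]
    simp [Fintype.sum_option (fun o => s o ^ 2 * _), hs_none, hs_sq, sum_expectationTable_right,
      (hF y).sum_eq_one]
  · obtain ⟨x⟩ := ‹Nonempty X›
    rw [(hF y).norm_sum_smul_sq, ← hTB x y]
    simp [Fintype.sum_option (fun o => s o ^ 2 * _), hs_none, hs_sq, sum_expectationTable_left,
      (hE x).sum_eq_one]
  · have hinner : ∀ o o', inner ℝ (E x o ψ) (F y o' ψ) = expectationTable ψ E F x y o o' :=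
      fun o o' => by
        rw [expectationTable, inner_mul_apply_of_star_eq ((hE x).selfAdjoint o),
          real_inner_eq_re_inner ℂ]
        rfl
    have h4 : (4 : ℝ) ^ q = 2 ^ q * (d * d') := by rw [hdd, ← mul_pow]; norm_num
    simp only [real_inner_smul_left, real_inner_smul_right, sum_inner, inner_sum, hinner]
    simp only [correlation, ← hTp, h4, Fintype.sum_option, hs_none, zero_mul, zero_add,
      Finset.mul_sum, Finset.sum_const_zero]
    rw [Finset.sum_comm]
    refine Finset.sum_congr rfl fun a _ => Finset.sum_congr rfl fun b _ => ?_
    simp only [s, Option.elim]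
    ring

theorem gammaTilde_uniformMarginals_correlation_le [Finite X] [Finite Y] [Nonempty X] [Nonempty Y]
    {q : ℕ} {p : Table X Y ℤˣ ℤˣ} (hp : QuantumSim q p) :
    gammaTilde (uniformMarginals (correlation p)) ≤ 2 ^ q := by
  obtain ⟨H, _, _, u, v, hu, hv, huv⟩ := hp.exists_unit_vectors
  have hpow : (1 : ℝ) ≤ 2 ^ q := one_le_pow₀ one_le_two
  have hpos := uniformMarginals_inner_mem_quantumSet hu hv
  have hneg := uniformMarginals_inner_mem_quantumSet (v := fun y => -v y) hu
    fun y => (norm_neg _).trans (hv y)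
  refine (affineCost_le ![(1 + 2 ^ q) / 2, (1 - 2 ^ q) / 2]
    ![uniformMarginals fun x y => inner ℝ (u x) (v y),
      uniformMarginals fun x y => inner ℝ (u x) (-v y)] ?_ ?_).trans_eq ?_
  · intro i
    fin_cases i
    exacts [hpos, hneg]
  · ext x y a b
    simp only [Fin.sum_univ_two, Matrix.cons_val_zero, Matrix.cons_val_one, Pi.add_apply,
      Pi.smul_apply, smul_eq_mul, uniformMarginals, huv, inner_neg_right]
    ring
  · simp only [Fin.sum_univ_two, Matrix.cons_val_zero, Matrix.cons_val_one]
    rw [abs_of_nonneg (by positivity), abs_of_nonpos (by linarith)]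
    ring

end Correlation

section Correlation

variable {X Y : Type*}

theorem correlation_uniformMarginals (C : X → Y → ℝ) : correlation (uniformMarginals C) = C := by
  ext x y
  simp only [correlation, uniformMarginals, sum_intUnits, Units.val_one, Units.val_neg,
    Int.cast_one, Int.cast_neg]
  ring

theorem nonSignaling_uniformMarginals {C : X → Y → ℝ} (hC : ∀ x y, C x y ∈ Set.Icc (-1 : ℝ) 1) :
    NonSignaling (uniformMarginals C) := by
  refine ⟨fun x y a b => ?_, fun x y => ?_, fun a x y y' => ?_, fun b x x' y => ?_⟩
  · obtain ⟨hC_lower, hC_upper⟩ := hC x y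
    rcases Int.units_eq_one_or a with rfl | rfl <;> rcases Int.units_eq_one_or b with rfl | rfl <;>
      simp [uniformMarginals] <;> linarith
  all_goals
    simp only [uniformMarginals, sum_intUnits, Units.val_one, Units.val_neg,
      Int.cast_one, Int.cast_neg]
    ring

theorem NonSignaling.correlation_mem_Icc {p : Table X Y ℤˣ ℤˣ} (hp : NonSignaling p) (x : X)
    (y : Y) : correlation p x y ∈ Set.Icc (-1 : ℝ) 1 := by
  have hsum := hp.sum_eq_one x y
  have hpos := hp.nonneg x y
  simp only [correlation, sum_intUnits, Units.val_one, Units.val_neg,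
    Int.cast_one, Int.cast_neg, Set.mem_Icc] at hsum ⊢
  constructor <;> linarith [hpos 1 1, hpos 1 (-1), hpos (-1) 1, hpos (-1) (-1)]

theorem NonSignaling.uniformMarginals_correlation_apply {p : Table X Y ℤˣ ℤˣ}
    (hp : NonSignaling p) (x : X) (y : Y) (a b : ℤˣ) :
    uniformMarginals (correlation p) x y a b = (p x y a b + p x y (-a) (-b)) / 2 := by
  have hsum := hp.sum_eq_one x y
  simp only [sum_intUnits] at hsum
  rcases Int.units_eq_one_or a with rfl | rfl <;> rcases Int.units_eq_one_or b with rfl | rfl <;>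
    simp only [uniformMarginals, correlation, sum_intUnits, Units.val_one, Units.val_neg,
      Int.cast_one, Int.cast_neg, neg_neg] <;> linarith

theorem uniformMarginals_neg_neg (C : X → Y → ℝ) (x : X) (y : Y) (a b : ℤˣ) :
    uniformMarginals C x y (-a) (-b) = uniformMarginals C x y a b := by
  simp [uniformMarginals]

theorem abs_sub_le_tvDist {A B : Type*} [Finite X] [Finite Y] [Finite A] [Finite B]
    (p p' : Table X Y A B) (x : X) (y : Y) (s : Finset (A × B)) :
    |∑ e ∈ s, p x y e.1 e.2 - ∑ e ∈ s, p' x y e.1 e.2| ≤ tvDist p p' :=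
  le_ciSup (f := fun z : X × Y × Finset (A × B) =>
    |∑ e ∈ z.2.2, p z.1 z.2.1 e.1 e.2 - ∑ e ∈ z.2.2, p' z.1 z.2.1 e.1 e.2|)
    (Set.finite_range _).bddAbove (x, y, s)

theorem tvDist_uniformMarginals_correlation_le [Finite X] [Finite Y] [Nonempty X] [Nonempty Y]
    (C : X → Y → ℝ) {p : Table X Y ℤˣ ℤˣ} (hp : NonSignaling p) :
    tvDist (uniformMarginals C) (uniformMarginals (correlation p)) ≤
      tvDist (uniformMarginals C) p := by
  refine ciSup_le fun ⟨x, y, s⟩ => ?_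
  -- The event `s` is compared with its image `s'` under flipping both outcomes.
  let s' := s.map ((Equiv.neg ℤˣ).prodCongr (Equiv.neg ℤˣ)).toEmbedding
  have hs' : ∀ f : ℤˣ → ℤˣ → ℝ, ∑ e ∈ s', f e.1 e.2 = ∑ e ∈ s, f (-e.1) (-e.2) :=
    fun f => Finset.sum_map _ _ _
  have hle := abs_sub_le_tvDist (uniformMarginals C) p x y s
  have hle' := abs_sub_le_tvDist (uniformMarginals C) p x y s'
  simp only [hs', uniformMarginals_neg_neg] at hle'
  simp only [hp.uniformMarginals_correlation_apply, ← Finset.sum_div, Finset.sum_add_distrib]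
  rw [abs_le] at hle hle' ⊢
  constructor <;> linarith

end Correlation

/-! ### Lower bounds for communication -/

section Complexity

theorem coe_le_of_ceil_le {r : ℝ} {N : ℕ∞} (h : (⌈r⌉₊ : ℕ∞) ≤ N) :
    (r : EReal) ≤ ((N : ENNReal) : EReal) :=
  calc (r : EReal) ≤ ((⌈r⌉₊ : ENNReal) : EReal) := by
        rw [← ENNReal.coe_natCast]
        exact EReal.coe_le_coe_iff.2 (Nat.le_ceil r)
    _ ≤ ((N : ENNReal) : EReal) :=
        EReal.coe_ennreal_le_coe_ennreal_iff.2 (by exact_mod_cast ENat.toENNReal_le.2 h)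

variable {X Y A B : Type*} {Sim : ℕ → Table X Y A B → Prop} {p : Table X Y A B} {r : ℝ}

theorem le_exactComplexity (h : ∀ t, Sim t p → r ≤ t) :
    (r : EReal) ≤ ((exactComplexity Sim p : ENNReal) : EReal) :=
  coe_le_of_ceil_le <| le_iInf₂ fun t ht => by exact_mod_cast Nat.ceil_le.2 (h t ht)

theorem le_approxComplexity [Fintype A] [Fintype B] {ε : ℝ}
    (h : ∀ p' t, NonSignaling p' → tvDist p p' ≤ ε → Sim t p' → r ≤ t) :
    (r : EReal) ≤ ((approxComplexity Sim ε p : ENNReal) : EReal) :=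
  coe_le_of_ceil_le <| le_iInf fun p' => le_iInf₂ fun hp' hε => le_iInf₂ fun t ht => by
    exact_mod_cast Nat.ceil_le.2 (h p' t hp' hε ht)

end Complexity

section Logb

variable {x : ℝ} {n : ℕ}

theorem logb_two_le_of_le_two_pow (hx : 0 ≤ x) (h : x ≤ 2 ^ n) : Real.logb 2 x ≤ n := by
  rcases hx.eq_or_lt with rfl | hpos
  · simp
  · rwa [Real.logb_le_iff_le_rpow one_lt_two hpos, Real.rpow_natCast]

theorem logb_two_sub_one_le (hx : 0 ≤ x) (h : x ≤ 2 * 2 ^ n - 1) : Real.logb 2 x - 1 ≤ n := by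
  have hlog := logb_two_le_of_le_two_pow hx (n := n + 1) (by rw [pow_succ]; linarith)
  push_cast at hlog
  linarith

theorem half_logb_two_sub_one_le (hx : 0 ≤ x) (h : x ≤ 2 * 4 ^ n - 1) :
    1 / 2 * Real.logb 2 x - 1 ≤ n := by
  have h4 : (4 : ℝ) ^ n = 2 ^ (2 * n) := by rw [pow_mul]; norm_num
  have hlog := logb_two_sub_one_le hx (n := 2 * n) (h4 ▸ h)
  push_cast at hlog
  linarith

end Logb

end

theorem mainTheorem2 {X Y A B : Type*} [Fintype X] [Fintype Y] [Fintype A] [Fintype B]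
    [Nonempty X] [Nonempty Y]
    (p : Table X Y A B) (hp : NonSignaling p)
    (C : X → Y → ℝ) (hC : ∀ x y, C x y ∈ Set.Icc (-1 : ℝ) 1)
    (ε : ℝ) (hε : 0 ≤ ε) :
    (((Real.logb 2 (nuTilde p) - 1 : ℝ) : EReal) ≤ ((R0pub p : ENNReal) : EReal) ∧
      ((Real.logb 2 (nuTildeApprox ε p) - 1 : ℝ) : EReal) ≤ ((Rpub ε p : ENNReal) : EReal)) ∧
    (((1 / 2 * Real.logb 2 (gammaTilde p) - 1 : ℝ) : EReal) ≤ ((Q0ent p : ENNReal) : EReal) ∧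
      ((1 / 2 * Real.logb 2 (gammaTildeApprox ε p) - 1 : ℝ) : EReal) ≤
        ((Qent ε p : ENNReal) : EReal)) ∧
    (((Real.logb 2 (gammaTilde (uniformMarginals C)) : ℝ) : EReal) ≤
        ((Q0ent (uniformMarginals C) : ENNReal) : EReal) ∧
      ((Real.logb 2 (gammaTildeApprox ε (uniformMarginals C)) : ℝ) : EReal) ≤
        ((Qent ε (uniformMarginals C) : ENNReal) : EReal)) := by
  refine ⟨⟨le_exactComplexity fun t ht => ?_, le_approxComplexity fun p' t hp' hd ht => ?_⟩,
    ⟨le_exactComplexity fun q hq => ?_, le_approxComplexity fun p' q hp' hd hq => ?_⟩,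
    le_exactComplexity fun q hq => ?_, le_approxComplexity fun p' q hp' hd hq => ?_⟩
  · exact logb_two_sub_one_le (affineCost_nonneg _ _) (nuTilde_le_of_classicalSim hp ht)
  · exact logb_two_sub_one_le (affineCostApprox_nonneg _ _ _)
      ((affineCostApprox_le hp' hd).trans (nuTilde_le_of_classicalSim hp' ht))
  · exact half_logb_two_sub_one_le (affineCost_nonneg _ _) (gammaTilde_le_of_quantumSim hp hq)
  · exact half_logb_two_sub_one_le (affineCostApprox_nonneg _ _ _)
      ((affineCostApprox_le hp' hd).trans (gammaTilde_le_of_quantumSim hp' hq))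
  · refine logb_two_le_of_le_two_pow (affineCost_nonneg _ _) ?_
    have := gammaTilde_uniformMarginals_correlation_le hq
    rwa [correlation_uniformMarginals] at this
  · exact logb_two_le_of_le_two_pow (affineCostApprox_nonneg _ _ _)
      ((affineCostApprox_le (nonSignaling_uniformMarginals hp'.correlation_mem_Icc)
        ((tvDist_uniformMarginals_correlation_le C hp').trans hd)).trans
        (gammaTilde_uniformMarginals_correlation_le hq))
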